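/- Let $0\le q<n$ and $d\ge 1$ be integers. For a positive definite $n\times n$ matrix $V$, let $\mathcal W(V,d)$ be the Wishart distribution with scale $V$ and $d$ degrees of freedom, i.e. the law of $FF^T$, where $F\in\mathbb R^{n\times d}$ has independent $N(0,V)$ columns (it is singular when $d<n$). MAP estimation means maximising likelihood times prior density, where the likelihood is a density of the model with respect to a common $\sigma$-finite reference measure, continuous at the observation within the support of that measure and evaluated at the observation. (1) Let $\hat S$ be a positive semidefinite $n\times n$ matrix with $q<\operatorname{rank}\hat S\le d$ and eigenvalues $\lambda_1\ge\dots\ge\lambda_n$, and put $\hat\sigma^2=\frac1{n-q}\sum_{i=q+1}^n\lambda_i$. Under the model $$\hat S\, d\mid X\sim\mathcal W(XX^T+\sigma^2I_n,\,d),\qquad X\in\mathbb R^{n\times q},\ \sigma^2>0,$$ with an improper uniform prior, $(X,\sigma^2)$ is a joint MAP estimate if and only if $\sigma^2=\hat\sigma^2$ and $$X=U_q(\Lambda_q-\hat\sigma^2I_q)^{1/2}R^T$$ for some $n\times q$ matrix $U_q$ whose columns are orthonormal eigenvectors of $\hat S$ for its $q$ largest eigenvalues $\Lambda_q=\operatorname{diag}(\lambda_1,\dots,\lambda_q)$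 and some orthogonal $q\times q$ matrix $R$. Moreover, with $\sigma^2$ held fixed at $\hat\sigma^2$ and an improper uniform prior on $X$, the MAP estimates of $X$ are exactly the matrices of this form. Here $\hat\sigma^2>0$ and $\Lambda_q-\hat\sigma^2I_q$ is positive semidefinite. (2) Let $\hat\Gamma$ be a positive definite $n\times n$ matrix, let $d\ge n$, let $\lambda_1\le\dots\le\lambda_n$ be the eigenvalues of $\hat\Gamma$, and put $\hat\beta=(n-q)\big/\sum_{i=q+1}^n\lambda_i$. Under the model $$\hat\Gamma\, d\mid X\sim\mathcal W\big((XX^T+\beta I_n)^{-1},\,d\big),\qquad X\in\mathbb R^{n\times q},\ \beta>0,$$ with an improper uniform prior, $(X,\beta)$ is a joint MAP estimate if and only if $\beta=\hat\beta$ and $$X=U_q(\Lambda_q^{-1}-\hat\beta I_q)^{1/2}R^T$$ for some $n\times q$ matrix $U_q$ whose columns are orthonormal eigenvectors of $\hat\Gamma$ for its $q$ smallest eigenvalues $\Lambda_q=\operatorname{diag}(\lambda_1,\dots,\lambda_q)$ and some orthogonal $q\times q$ matrix $R$. Moreover, with $\beta$ held fixed at $\hat\beta$ and an improper uniform prior on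 $X$, the MAP estimates of $X$ are exactly the matrices of this form. Here $\hat\beta>0$ and $\Lambda_q^{-1}-\hat\beta I_q$ is positive semidefinite. -/

import Mathlib

open MeasureTheory ProbabilityTheory Matrix
open scoped NNReal ENNReal

noncomputable section

/-- Real matrices carry the Borel sigma-algebra. -/
instance matrixMeasurableSpace (m n : ℕ) : MeasurableSpace (Matrix (Fin m) (Fin n) ℝ) :=
  borel _

instance matrixBorelSpace (m n : ℕ) : BorelSpace (Matrix (Fin m) (Fin n) ℝ) := ⟨rfl⟩

/-- The `n × d` matrix with the given columns. -/
def colMatrix {n d : ℕ} (f : Fin d → EuclideanSpace ℝ (Fin n)) : Matrix (Fin n) (Fin d) ℝ :=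
  Matrix.of fun i k => f k i

/-- The Wishart distribution `𝒲(V, d)` with scale matrix `V` and `d` degrees of freedom: the law of
`F Fᵀ`, where the `d` columns of `F` are independent `N(0, V)` vectors. It is singular, concentrated
on the matrices of rank `d`, when `d < n` and `V` is positive definite. -/
def wishart {n : ℕ} (V : Matrix (Fin n) (Fin n) ℝ) (d : ℕ) :
    Measure (Matrix (Fin n) (Fin n) ℝ) :=
  (Measure.pi fun _ : Fin d => multivariateGaussian (0 : EuclideanSpace ℝ (Fin n)) V).map
    fun f => colMatrix f * (colMatrix f)ᵀ

/-- `L` is a likelihood of the statistical model `P` at the observation `y`: for a sigma-finite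
reference measure `ν` common to the whole model, `L θ` is the value at `y` of the density of `P θ`
with respect to `ν`, the versions of the densities being continuous at `y` (within the support of
`ν`, which contains `y`) so that their values at `y` are meaningful, and not all zero at `y`.
For positive definite `y` and `d ≥ n` the Lebesgue density of the Wishart distribution is an
instance; for `d < n` and `y` of rank `d` the density of the singular Wishart distribution is one.
-/
def IsLikelihood {Θ 𝓜 : Type*} [TopologicalSpace 𝓜] [MeasurableSpace 𝓜]
    (P : Θ → Measure 𝓜) (y : 𝓜) (L : Θ → ℝ≥0) : Prop :=
  ∃ (ν : Measure 𝓜) (p : Θ → 𝓜 → ℝ≥0),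
    SigmaFinite ν ∧
    (∀ θ, Measurable (p θ)) ∧
    (∀ θ, P θ = ν.withDensity fun z => (p θ z : ℝ≥0∞)) ∧
    y ∈ ν.support ∧
    (∀ θ, ContinuousWithinAt (p θ) ν.support y) ∧
    (∃ θ, 0 < p θ y) ∧
    ∀ θ, L θ = p θ y

/-- `θ` is a maximum a posteriori estimate, for the model `P` and the (possibly improper) prior
density `π₀`, given the observation `y`: it maximizes the unnormalized posterior density, the
product of likelihood and prior. -/
def IsMAP {Θ 𝓜 : Type*} [TopologicalSpace 𝓜] [MeasurableSpace 𝓜]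
    (P : Θ → Measure 𝓜) (π₀ : Θ → ℝ≥0) (y : 𝓜) (θ : Θ) : Prop :=
  ∃ L : Θ → ℝ≥0, IsLikelihood P y L ∧ ∀ θ', L θ' * π₀ θ' ≤ L θ * π₀ θ

/-- The improper uniform prior. -/
def flatPrior (Θ : Type*) : Θ → ℝ≥0 := fun _ => 1

/-- The eigenvalues of a symmetric matrix, with multiplicity, in decreasing order. -/
def eigDesc {n : ℕ} {M : Matrix (Fin n) (Fin n) ℝ} (hM : M.IsHermitian) (i : Fin n) : ℝ :=
  hM.eigenvalues₀ (Fin.cast (Fintype.card_fin n).symm i)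

/-- The eigenvalues of a symmetric matrix, with multiplicity, in increasing order. -/
def eigAsc {n : ℕ} {M : Matrix (Fin n) (Fin n) ℝ} (hM : M.IsHermitian) (i : Fin n) : ℝ :=
  eigDesc hM i.rev

/-- The `q` largest eigenvalues. -/
def majorEig {n q : ℕ} (hq : q < n) {M : Matrix (Fin n) (Fin n) ℝ} (hM : M.IsHermitian)
    (j : Fin q) : ℝ :=
  eigDesc hM (Fin.castLE hq.le j)

/-- The `q` smallest eigenvalues. -/
def minorEig {n q : ℕ} (hq : q < n) {M : Matrix (Fin n) (Fin n) ℝ} (hM : M.IsHermitian)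
    (j : Fin q) : ℝ :=
  eigAsc hM (Fin.castLE hq.le j)

/-- `σ̂² = (∑_{i > q} λᵢ) / (n - q)`, with `λ₁ ≥ … ≥ λₙ`. -/
def sigmaSqHat {n : ℕ} (q : ℕ) {M : Matrix (Fin n) (Fin n) ℝ} (hM : M.IsHermitian) : ℝ :=
  (∑ i ∈ Finset.univ.filter (fun i : Fin n => q ≤ i.val), eigDesc hM i) / ((n : ℝ) - (q : ℝ))

/-- `β̂ = (n - q) / ∑_{i > q} λᵢ`, with `λ₁ ≤ … ≤ λₙ`. -/
def betaHat {n : ℕ} (q : ℕ) {M : Matrix (Fin n) (Fin n) ℝ} (hM : M.IsHermitian) : ℝ :=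
  ((n : ℝ) - (q : ℝ)) / ∑ i ∈ Finset.univ.filter (fun i : Fin n => q ≤ i.val), eigAsc hM i

/-- The columns of `U` are orthonormal eigenvectors of `M` with eigenvalues `l`. -/
def IsEigenvectors {n q : ℕ} (M : Matrix (Fin n) (Fin n) ℝ) (l : Fin q → ℝ)
    (U : Matrix (Fin n) (Fin q) ℝ) : Prop :=
  Uᵀ * U = 1 ∧ M * U = U * diagonal l

/-- `X = U_q (Λ_q - s I)^{1/2} Rᵀ`, where the columns of `U_q` are `q` major eigenvectors of `M`,
`Λ_q` is the diagonal matrix of their eigenvalues, and `R` is orthogonal. -/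
def IsScaledMajor {n q : ℕ} (hq : q < n) {M : Matrix (Fin n) (Fin n) ℝ} (hM : M.IsHermitian)
    (s : ℝ) (X : Matrix (Fin n) (Fin q) ℝ) : Prop :=
  ∃ U : Matrix (Fin n) (Fin q) ℝ, ∃ R ∈ orthogonalGroup (Fin q) ℝ,
    IsEigenvectors M (majorEig hq hM) U ∧
    X = U * diagonal (fun j => Real.sqrt (majorEig hq hM j - s)) * Rᵀ

/-- `X = U_q (Λ_q⁻¹ - b I)^{1/2} Rᵀ`, where the columns of `U_q` are `q` minor eigenvectors of `M`,
`Λ_q` is the diagonal matrix of their eigenvalues, and `R` is orthogonal. -/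
def IsScaledMinor {n q : ℕ} (hq : q < n) {M : Matrix (Fin n) (Fin n) ℝ} (hM : M.IsHermitian)
    (b : ℝ) (X : Matrix (Fin n) (Fin q) ℝ) : Prop :=
  ∃ U : Matrix (Fin n) (Fin q) ℝ, ∃ R ∈ orthogonalGroup (Fin q) ℝ,
    IsEigenvectors M (minorEig hq hM) U ∧
    X = U * diagonal (fun j => Real.sqrt ((minorEig hq hM j)⁻¹ - b)) * Rᵀ

end

/-! The Lebesgue density of a Gaussian `F` with independent `N(0, V)` columns depends on `F` only
through `F Fᵀ`. Hence all Wishart laws with positive definite scale and the same `d` have positive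
continuous densities with respect to one measure, the image of Lebesgue measure under `F ↦ F Fᵀ`,
even when they are singular. Their ratios are continuous, so a likelihood at a point of the support
is determined up to a factor independent of the parameter (`isMAP_flatPrior_iff`). MAP estimation at
`d • S` therefore means minimising `log det V + tr (V⁻¹ S)`, once `d • S` is written as some `F Fᵀ`,
which needs rank at most `d`.

For `V = X Xᵀ + s I`, with eigenvalues `μ` of which the last `n - q` equal `s`, von Neumann's trace
inequality bounds the loss below by `∑ (log μᵢ + lᵢ / μᵢ)`. By `log x ≤ x - 1` this is least when
`μᵢ = lᵢ` for the first `q` indices and `s` is the mean of the remaining `lᵢ`. Equality fixes the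
eigenvalues of `V`, and equality in the trace inequality makes its leading eigenvectors eigenvectors
of `S`, including when eigenvalues coincide. Conversely, a low-rank determinant and inverse
computation shows that every such `V` attains the bound. Finally `X Xᵀ` determines `X` up to an
orthogonal factor on the right.

For the precision model the same argument pairs `X Xᵀ + b I` with `-G` instead of `-V⁻¹` with `S`,
so that the smallest eigenvalues are selected. -/

/-! ### Gaussian and Wishart densities. -/

theorem lintegral_pi_prod {E : Type*} [MeasurableSpace E] :
    ∀ {n : ℕ} (μ : Fin n → Measure E) [∀ i, SigmaFinite (μ i)] (f : Fin n → E → ℝ≥0∞),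
      (∀ i, Measurable (f i)) →
      ∫⁻ x, ∏ i, f i (x i) ∂(Measure.pi μ) = ∏ i, ∫⁻ x, f i x ∂(μ i)
  | 0, μ, _, f, _ => by simp
  | n + 1, μ, _, f, hf => by
    have hm : Measurable fun x : Fin (n + 1) → E => ∏ i, f i (x i) :=
      Finset.measurable_prod _ fun i _ => (hf i).comp (measurable_pi_apply i)
    rw [← (measurePreserving_piFinSuccAbove μ 0).symm.lintegral_comp hm,
      Fin.prod_univ_succ, ← lintegral_pi_prod (fun i => μ i.succ) (fun i => f i.succ)
        (fun i => hf _), ← lintegral_prod_mul (hf 0).aemeasurable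
        (Finset.measurable_fun_prod _ fun i _ => (hf i.succ).comp (measurable_pi_apply i)).aemeasurable]
    refine lintegral_congr fun x => ?_
    simp [Fin.prod_univ_succ, MeasurableEquiv.piFinSuccAbove_symm_apply, Fin.insertNthEquiv]

theorem pi_withDensity {E : Type*} [MeasurableSpace E] {n : ℕ} (μ : Fin n → Measure E)
    [∀ i, SigmaFinite (μ i)] (f : Fin n → E → ℝ≥0∞) (hf : ∀ i, Measurable (f i))
    [∀ i, SigmaFinite ((μ i).withDensity (f i))] :
    Measure.pi (fun i => (μ i).withDensity (f i)) =
      (Measure.pi μ).withDensity fun x => ∏ i, f i (x i) := by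
  refine Measure.pi_eq fun s hs => ?_
  rw [withDensity_apply _ (MeasurableSet.univ_pi hs), Measure.restrict_pi_pi,
    lintegral_pi_prod _ _ hf]
  exact Finset.prod_congr rfl fun i _ => (withDensity_apply _ (hs i)).symm

theorem map_withDensity_comp {α β : Type*} [MeasurableSpace α] [MeasurableSpace β]
    (μ : Measure α) {f : α → β} (hf : Measurable f) {g : β → ℝ≥0∞} (hg : Measurable g) :
    (μ.withDensity fun x => g (f x)).map f = (μ.map f).withDensity g := by
  ext s hs
  rw [Measure.map_apply hf hs, withDensity_apply _ (hf hs), withDensity_apply _ hs,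
    setLIntegral_map hs hg hf]

/-- The normalizing constant of the standard Gaussian density on `ℝⁿ`. -/
noncomputable def gaussianConst (n : ℕ) : ℝ := (√(2 * Real.pi))⁻¹ ^ n

theorem gaussianConst_pos (n : ℕ) : 0 < gaussianConst n := by
  unfold gaussianConst; positivity

theorem stdGaussian_eq_withDensity (n : ℕ) :
    stdGaussian (EuclideanSpace ℝ (Fin n)) = volume.withDensity fun x =>
      ENNReal.ofReal (gaussianConst n * Real.exp (-(x.ofLp ⬝ᵥ x.ofLp) / 2)) := by
  have h1 : gaussianReal 0 1 = volume.withDensity (gaussianPDF 0 1) :=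
    gaussianReal_of_var_ne_zero 0 one_ne_zero
  have : SigmaFinite ((volume : Measure ℝ).withDensity (gaussianPDF 0 1)) := by
    rw [← h1]; infer_instance
  rw [← map_pi_eq_stdGaussian, h1, pi_withDensity (fun _ => volume) (fun _ => gaussianPDF 0 1)
    (fun _ => measurable_gaussianPDF 0 1), ← (PiLp.volume_preserving_toLp (Fin n)).map_eq,
    ← volume_pi, ← map_withDensity_comp _ (by fun_prop) (by fun_prop)]
  congr 2
  funext x
  simp only [gaussianPDF]
  rw [← ENNReal.ofReal_prod_of_nonneg fun i _ => gaussianPDFReal_nonneg _ _ _]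
  congr 1
  simp only [gaussianPDFReal, Finset.prod_mul_distrib, ← Real.exp_sum, gaussianConst]
  simp [dotProduct, Finset.sum_div, Finset.sum_neg_distrib, pow_two, neg_div]

/-- Change of variables under the symmetric square root `A` of `V`. The Jacobian factor `(det A)⁻¹`
is moved into the exponent as `-(log det V) / 2`, so that a product over columns becomes a sum in
one exponential. -/
theorem multivariateGaussian_eq_withDensity {n : ℕ} {V : Matrix (Fin n) (Fin n) ℝ}
    (hV : V.PosDef) :
    multivariateGaussian (0 : EuclideanSpace ℝ (Fin n)) V = volume.withDensity fun x =>
      ENNReal.ofReal (gaussianConst n *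
        Real.exp (-(Real.log V.det + x.ofLp ⬝ᵥ V⁻¹ *ᵥ x.ofLp) / 2)) := by
  open scoped MatrixOrder in
  obtain ⟨A, hA, hAs, hAn⟩ : ∃ A, A * A = V ∧ A = CFC.sqrt V ∧ A.PosSemidef :=
    ⟨CFC.sqrt V, CFC.sqrt_mul_sqrt_self _ hV.posSemidef.nonneg, rfl,
      Matrix.nonneg_iff_posSemidef.1 (CFC.sqrt_nonneg V)⟩
  have hAt : Aᵀ = A := by simpa using hAn.isHermitian.eq
  have hdet : A.det * A.det = V.det := by rw [← det_mul, hA]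
  have hdV := hV.det_pos
  have hd0 : A.det ≠ 0 := fun h => by rw [h] at hdet; simp at hdet; linarith
  have hdp : 0 < A.det := lt_of_le_of_ne hAn.det_nonneg hd0.symm
  have hVi : V⁻¹ = A⁻¹ * A⁻¹ := by rw [← hA, Matrix.mul_inv_rev]
  have hAi : A⁻¹ * A = 1 := nonsing_inv_mul _ hd0.isUnit
  have hAi' : A * A⁻¹ = 1 := mul_nonsing_inv _ hd0.isUnit
  set f : EuclideanSpace ℝ (Fin n) →ₗ[ℝ] EuclideanSpace ℝ (Fin n) := toEuclideanLin A with hf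
  have hdf : LinearMap.det f = A.det := by
    exact LinearMap.det_toLpLin 2 A
  have hfm : Measurable f := f.continuous_of_finiteDimensional.measurable
  have hg : Measurable fun x : EuclideanSpace ℝ (Fin n) => ENNReal.ofReal (gaussianConst n *
      Real.exp (-(x.ofLp ⬝ᵥ V⁻¹ *ᵥ x.ofLp) / 2)) := by
    refine ENNReal.measurable_ofReal.comp ?_
    refine Continuous.measurable ?_
    simp only [dotProduct, mulVec]
    fun_prop
  rw [multivariateGaussian, ← hAs, stdGaussian_eq_withDensity]
  have h1 : (fun x : EuclideanSpace ℝ (Fin n) => 0 + toEuclideanCLM (𝕜 := ℝ) A x) = f := by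
    funext x; rw [zero_add]; rfl
  rw [h1]
  have h2 : (fun x : EuclideanSpace ℝ (Fin n) => ENNReal.ofReal (gaussianConst n *
      Real.exp (-(x.ofLp ⬝ᵥ x.ofLp) / 2))) = fun x => ENNReal.ofReal (gaussianConst n *
      Real.exp (-((f x).ofLp ⬝ᵥ V⁻¹ *ᵥ (f x).ofLp) / 2)) := by
    funext x
    have : (f x).ofLp ⬝ᵥ V⁻¹ *ᵥ (f x).ofLp = x.ofLp ⬝ᵥ x.ofLp := by
      have : (f x).ofLp = A *ᵥ x.ofLp := rfl
      rw [this, hVi, mulVec_mulVec, mul_assoc, hAi, mul_one, dotProduct_comm,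
        dotProduct_mulVec, vecMul_mulVec, transpose_nonsing_inv, hAt, hAi, vecMul_one]
    rw [this]
  rw [h2, map_withDensity_comp _ hfm hg, Measure.map_linearMap_addHaar_eq_smul_addHaar _
    (by rwa [hdf]), hdf, withDensity_smul_measure, ← withDensity_smul _ hg]
  congr 1
  funext x
  simp only [Pi.smul_apply, smul_eq_mul]
  rw [← ENNReal.ofReal_mul (abs_nonneg _), abs_of_pos (inv_pos.2 hdp), neg_add, add_div, Real.exp_add,
    ← hdet, Real.log_mul hd0 hd0, show -(Real.log A.det + Real.log A.det) / 2 = -Real.log A.det by ring,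
    Real.exp_neg, Real.exp_log hdp]
  congr 1
  ring

/-- Up to a factor depending only on the reference measure, the density at `y` of the Wishart
distribution with scale `V` and `d` degrees of freedom. -/
noncomputable def wishartKernel {n : ℕ} (d : ℕ) (V y : Matrix (Fin n) (Fin n) ℝ) : ℝ≥0 :=
  Real.toNNReal (Real.exp (-(d * Real.log V.det + (V⁻¹ * y).trace) / 2))

theorem wishartKernel_pos {n : ℕ} (d : ℕ) (V y : Matrix (Fin n) (Fin n) ℝ) :
    0 < wishartKernel d V y := Real.toNNReal_pos.2 (Real.exp_pos _)

theorem continuous_wishartKernel {n : ℕ} (d : ℕ) (V : Matrix (Fin n) (Fin n) ℝ) :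
    Continuous (wishartKernel d V) := by
  unfold wishartKernel
  exact continuous_real_toNNReal.comp (by fun_prop)

theorem continuous_colMatrix_mul_transpose (n d : ℕ) :
    Continuous fun f : Fin d → EuclideanSpace ℝ (Fin n) => colMatrix f * (colMatrix f)ᵀ := by
  have : Continuous fun f : Fin d → EuclideanSpace ℝ (Fin n) => colMatrix f := by
    unfold colMatrix
    exact continuous_matrix fun i j => by simp only [of_apply]; fun_prop
  fun_prop

theorem trace_mul_colMatrix_mul_transpose {n d : ℕ} (A : Matrix (Fin n) (Fin n) ℝ)
    (f : Fin d → EuclideanSpace ℝ (Fin n)) :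
    (A * (colMatrix f * (colMatrix f)ᵀ)).trace = ∑ k, (f k).ofLp ⬝ᵥ A *ᵥ (f k).ofLp := by
  rw [← Matrix.mul_assoc, trace_mul_comm, ← Matrix.mul_assoc]
  simp only [trace, diag, mul_apply, dotProduct, mulVec, transpose_apply, colMatrix, of_apply,
    Finset.sum_mul, Finset.mul_sum]
  refine Finset.sum_congr rfl fun k _ => ?_
  rw [Finset.sum_comm]
  exact Finset.sum_congr rfl fun i _ => Finset.sum_congr rfl fun j _ => by ring

instance isProbabilityMeasure_wishart {n : ℕ} (V : Matrix (Fin n) (Fin n) ℝ) (d : ℕ) :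
    IsProbabilityMeasure (wishart V d) :=
  Measure.isProbabilityMeasure_map
    (continuous_colMatrix_mul_transpose n d).measurable.aemeasurable

/-- The quadratic forms of the columns add up to `tr (V⁻¹ F Fᵀ)`, so the density of `F` factors
through `F Fᵀ` and passes to the image measure. No relation between `d` and `n` is needed. -/
theorem wishart_eq_withDensity {n : ℕ} (d : ℕ) {V : Matrix (Fin n) (Fin n) ℝ} (hV : V.PosDef) :
    wishart V d =
      ((volume : Measure (Fin d → EuclideanSpace ℝ (Fin n))).map fun f =>
        colMatrix f * (colMatrix f)ᵀ).withDensity fun y =>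
          ENNReal.ofReal (gaussianConst n ^ d) * wishartKernel d V y := by
  have hm : Measurable fun x : EuclideanSpace ℝ (Fin n) => ENNReal.ofReal (gaussianConst n *
      Real.exp (-(Real.log V.det + x.ofLp ⬝ᵥ V⁻¹ *ᵥ x.ofLp) / 2)) := by
    refine ENNReal.measurable_ofReal.comp (Continuous.measurable ?_)
    simp only [dotProduct, mulVec]
    fun_prop
  have h1 := multivariateGaussian_eq_withDensity hV
  have : SigmaFinite ((volume : Measure (EuclideanSpace ℝ (Fin n))).withDensity fun x =>
      ENNReal.ofReal (gaussianConst n *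
      Real.exp (-(Real.log V.det + x.ofLp ⬝ᵥ V⁻¹ *ᵥ x.ofLp) / 2))) := by
    rw [← h1]; infer_instance
  rw [wishart, h1, pi_withDensity (fun _ => volume) _ fun _ => hm, ← map_withDensity_comp _
    (continuous_colMatrix_mul_transpose n d).measurable
    ((continuous_wishartKernel d V).measurable.coe_nnreal_ennreal.const_mul _), ← volume_pi]
  congr 2
  funext f
  have hc := (gaussianConst_pos n).le
  rw [← ENNReal.ofReal_prod_of_nonneg fun i _ => by positivity, wishartKernel,
    ← ENNReal.ofReal, ← ENNReal.ofReal_mul (by positivity)]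
  rw [Finset.prod_mul_distrib, ← Real.exp_sum, trace_mul_colMatrix_mul_transpose]
  simp [← Finset.sum_div, Finset.sum_add_distrib]

theorem wishart_eq_withDensity_wishart {n : ℕ} (d : ℕ) {V V₀ : Matrix (Fin n) (Fin n) ℝ}
    (hV : V.PosDef) (hV₀ : V₀.PosDef) :
    wishart V d = (wishart V₀ d).withDensity fun y =>
      ((wishartKernel d V y / wishartKernel d V₀ y : ℝ≥0) : ℝ≥0∞) := by
  rw [wishart_eq_withDensity d hV, wishart_eq_withDensity d hV₀, ← withDensity_mul]
  · congr 1
    funext y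
    simp only [Pi.mul_apply]
    rw [mul_assoc, ← ENNReal.coe_mul, mul_div_cancel₀ _ (wishartKernel_pos d V₀ y).ne']
  · exact (continuous_wishartKernel d V₀).measurable.coe_nnreal_ennreal.const_mul _
  · exact ((continuous_wishartKernel d V).measurable.div
      (continuous_wishartKernel d V₀).measurable).coe_nnreal_ennreal

/-- The preimage of a neighbourhood of `F Fᵀ` is a neighbourhood of `F`, hence has positive Lebesgue
measure, and the Wishart density vanishes nowhere. -/
theorem colMatrix_mul_transpose_mem_support_wishart {n d : ℕ}
    (f : Fin d → EuclideanSpace ℝ (Fin n)) {V : Matrix (Fin n) (Fin n) ℝ} (hV : V.PosDef) :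
    colMatrix f * (colMatrix f)ᵀ ∈ (wishart V d).support := by
  have hc := continuous_colMatrix_mul_transpose n d
  have hle : (volume : Measure (Fin d → EuclideanSpace ℝ (Fin n))).map (fun f =>
        colMatrix f * (colMatrix f)ᵀ) ≪ wishart V d := by
    rw [wishart_eq_withDensity d hV]
    refine withDensity_absolutelyContinuous'
      ((continuous_wishartKernel d V).measurable.coe_nnreal_ennreal.const_mul _).aemeasurable ?_
    refine Filter.Eventually.of_forall fun y => mul_ne_zero ?_ ?_
    · exact (ENNReal.ofReal_pos.2 (pow_pos (gaussianConst_pos n) d)).ne'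
    · exact_mod_cast (wishartKernel_pos d V y).ne'
  refine hle.support_mono ?_
  rw [Measure.mem_support_iff_forall]
  intro U hU
  refine lt_of_lt_of_le ?_ (Measure.le_map_apply hc.measurable.aemeasurable _)
  exact Measure.measure_pos_of_mem_nhds _ (hc.continuousAt hU)

/-! ### Independence of MAP estimates from the reference measure. -/

section MAP

variable {Θ 𝓜 : Type*} [TopologicalSpace 𝓜] [MeasurableSpace 𝓜]
  [HereditarilyLindelofSpace 𝓜]

/-- Two functions that agree almost everywhere and are continuous, within the support, at a point
of the support agree at that point. -/
theorem eq_of_ae_eq_of_continuousWithinAt_support {ν : Measure 𝓜} {f g : 𝓜 → ℝ≥0} {y : 𝓜}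
    (hfg : f =ᵐ[ν] g) (hy : y ∈ ν.support) (hf : ContinuousWithinAt f ν.support y)
    (hg : ContinuousWithinAt g ν.support y) : f y = g y := by
  -- Every neighbourhood of `y` has positive measure while the support is conull (here the
  -- hereditarily Lindelöf hypothesis enters), so each one contains a support point where `f` and
  -- `g` agree.
  have hfr : ∃ᶠ z in nhdsWithin y ν.support, f z = g z := by
    rw [Filter.frequently_iff]
    intro U hU
    obtain ⟨T, hT, hTU⟩ := mem_nhdsWithin_iff_exists_mem_nhds_inter.1 hU
    have hpos := (Measure.mem_support_iff_forall y).1 hy T hT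
    have hae : ∀ᵐ z ∂ν, z ∈ ν.support ∧ f z = g z := Filter.Eventually.and
      Measure.support_mem_ae hfg
    by_contra! hcon
    refine hpos.ne' (measure_mono_null (t := {z | ¬ (z ∈ ν.support ∧ f z = g z)}) ?_ hae)
    rintro z hz ⟨hz1, hz2⟩
    exact hcon z (hTU ⟨hz, hz1⟩) hz2
  by_contra hne
  have : ∀ᶠ z in nhdsWithin y ν.support, f z ≠ g z :=
    (hf.tendsto.prodMk_nhds hg.tendsto).eventually (isOpen_ne_fun continuous_fst continuous_snd |>.mem_nhds hne)
  exact hfr this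

/-- Any admissible likelihood is a positive constant times `r · y`: two densities of the model
differ by the continuous factor `r θ / r θ₀` almost everywhere, hence also at `y`, and some `θ₀` has
positive density there. -/
theorem isMAP_flatPrior_iff [BorelSpace 𝓜] {P : Θ → Measure 𝓜} {y : 𝓜} (r : Θ → 𝓜 → ℝ≥0)
    (hr : ∀ θ, Continuous (r θ)) (hpos : ∀ θ z, 0 < r θ z)
    [∀ θ, IsFiniteMeasure (P θ)]
    (hP : ∀ θ θ₀, P θ = (P θ₀).withDensity fun z => ((r θ z / r θ₀ z : ℝ≥0) : ℝ≥0∞))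
    (hy : ∀ θ, y ∈ (P θ).support) (θ : Θ) :
    IsMAP P (flatPrior Θ) y θ ↔ ∀ θ', r θ' y ≤ r θ y := by
  constructor
  · rintro ⟨L, ⟨ν, p, hν, hpm, hPp, hyν, hpc, ⟨θ₀, hθ₀⟩, hL⟩, hmax⟩ θ'
    have key : ∀ θ, p θ y = p θ₀ y * (r θ y / r θ₀ y) := by
      intro θ
      have hcr : Continuous fun z => r θ z / r θ₀ z :=
        (hr θ).div (hr θ₀) fun z => (hpos θ₀ z).ne'
      have h1 := hP θ θ₀
      rw [hPp θ, hPp θ₀, ← withDensity_mul _ (hpm θ₀).coe_nnreal_ennreal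
        hcr.measurable.coe_nnreal_ennreal,
        withDensity_eq_iff_of_sigmaFinite (hpm θ).coe_nnreal_ennreal.aemeasurable
        ((hpm θ₀).coe_nnreal_ennreal.mul hcr.measurable.coe_nnreal_ennreal).aemeasurable] at h1
      refine eq_of_ae_eq_of_continuousWithinAt_support (g := fun z => p θ₀ z * (r θ z / r θ₀ z))
        ?_ hyν (hpc θ) ((hpc θ₀).mul hcr.continuousWithinAt)
      filter_upwards [h1] with z hz
      simp only [Pi.mul_apply] at hz
      exact_mod_cast hz
    have h := hmax θ'
    simp only [flatPrior, mul_one, hL] at h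
    rw [key θ, key θ'] at h
    have h' := le_of_mul_le_mul_left h hθ₀
    exact (div_le_div_iff_of_pos_right (hpos θ₀ y)).1 h'
  · intro h
    -- The finite measure `P θ` itself serves as the reference measure.
    refine ⟨fun θ' => r θ' y / r θ y, ⟨P θ, fun θ' z => r θ' z / r θ z, inferInstance, ?_,
      fun θ' => hP θ' θ, hy θ, ?_, ⟨θ, div_pos (hpos _ _) (hpos _ _)⟩, fun _ => rfl⟩, ?_⟩
    · exact fun θ' => (hr θ').measurable.div (hr θ).measurable
    · exact fun θ' => ((hr θ').div (hr θ) fun z => (hpos θ z).ne').continuousWithinAt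
    · intro θ'
      simp only [flatPrior, mul_one]
      exact (div_le_div_iff_of_pos_right (hpos θ y)).2 (h θ')

end MAP

instance matrixSecondCountable (m n : ℕ) : SecondCountableTopology (Matrix (Fin m) (Fin n) ℝ) :=
  inferInstanceAs (SecondCountableTopology (Fin m → Fin n → ℝ))

/-- `2 / d` times the negative log-likelihood of the scale matrix `V`, up to a constant, of a Wishart
model with `d` degrees of freedom observed at `d • S`. -/
noncomputable def wishartLoss {n : ℕ} (S V : Matrix (Fin n) (Fin n) ℝ) : ℝ :=
  Real.log V.det + (V⁻¹ * S).trace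

theorem isMAP_wishart_iff {Θ : Type*} {n d : ℕ} (hd : 0 < d)
    {V : Θ → Matrix (Fin n) (Fin n) ℝ} (hV : ∀ θ, (V θ).PosDef) {S : Matrix (Fin n) (Fin n) ℝ}
    {f : Fin d → EuclideanSpace ℝ (Fin n)} (hS : colMatrix f * (colMatrix f)ᵀ = (d : ℝ) • S)
    (θ : Θ) :
    IsMAP (fun θ => wishart (V θ) d) (flatPrior Θ) ((d : ℝ) • S) θ ↔
      ∀ θ', wishartLoss S (V θ) ≤ wishartLoss S (V θ') := by
  rw [isMAP_flatPrior_iff (fun θ => wishartKernel d (V θ)) (fun θ => continuous_wishartKernel d _)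
    (fun θ => wishartKernel_pos d _) (fun θ θ₀ => wishart_eq_withDensity_wishart d (hV θ) (hV θ₀))
    (fun θ => hS ▸ colMatrix_mul_transpose_mem_support_wishart f (hV θ))]
  refine forall_congr' fun θ' => ?_
  have hd' : (0 : ℝ) < d := by exact_mod_cast hd
  have key : ∀ θ, -(d * Real.log (V θ).det + ((V θ)⁻¹ * ((d : ℝ) • S)).trace) / 2 =
      -(d / 2 * wishartLoss S (V θ)) := fun θ => by
    rw [Matrix.mul_smul, trace_smul, wishartLoss, smul_eq_mul]; ring
  rw [wishartKernel, wishartKernel, key, key, Real.toNNReal_le_toNNReal_iff (Real.exp_pos _).le,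
    Real.exp_le_exp, neg_le_neg_iff, mul_le_mul_iff_right₀ (by positivity)]

/-! ### Rearrangement inequality with its equality case. -/

section Rearrangement

/-- A dual certificate for the transport problem with gain `a i * b j`, when `a` and `b` are
decreasing: the increments of the second potential. -/
def transportPotential (a b : ℕ → ℝ) (j : ℕ) : ℝ :=
  ∑ k ∈ Finset.range j, (a k + a (k + 1)) * (b (k + 1) - b k)

/-- The gap telescopes, up to sign, into terms `(2 a i - a k - a (k + 1)) * (b k - b (k + 1))` for
`k` between `i` and `j`, each contributing nonnegatively. Using both `a k` and `a (k + 1)` matters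
for equality: with only one of them, the term adjacent to `i` would vanish identically in one of the
two directions and say nothing about `b`. -/
theorem transportPotential_gap {a b : ℕ → ℝ} {n : ℕ} (ha : ∀ k l, k ≤ l → l < n → a l ≤ a k)
    (hb : ∀ k l, k ≤ l → l < n → b l ≤ b k) {i j : ℕ} (hi : i < n) (hj : j < n) :
    0 ≤ 2 * a i * (b i - b j) + transportPotential a b j - transportPotential a b i ∧
      ((∀ k < n, b k ≠ b i → a k ≠ a i) →
        2 * a i * (b i - b j) + transportPotential a b j - transportPotential a b i = 0 →
          b j = b i) := by
  rcases le_total i j with hij | hij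
  · induction j, hij using Nat.le_induction with
    | base => simp
    | succ j hij ih =>
      obtain ⟨ih1, ih2⟩ := ih (by omega)
      have e : 2 * a i * (b i - b (j + 1)) + transportPotential a b (j + 1) -
          transportPotential a b i = (2 * a i * (b i - b j) + transportPotential a b j -
          transportPotential a b i) + ((a i - a j) + (a i - a (j + 1))) * (b j - b (j + 1)) := by
        rw [transportPotential, Finset.sum_range_succ, ← transportPotential]; ring
      have h1 := ha i j hij (by omega)
      have h2 := ha i (j + 1) (by omega) hj
      have h3 := hb j (j + 1) (by omega) hj
      have h4 : 0 ≤ ((a i - a j) + (a i - a (j + 1))) * (b j - b (j + 1)) :=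
        mul_nonneg (by linarith) (by linarith)
      rw [e]
      refine ⟨by linarith, fun H h => ?_⟩
      have hbj := ih2 H (by linarith)
      have h6 : ((a i - a j) + (a i - a (j + 1))) * (b j - b (j + 1)) = 0 := by linarith
      rcases mul_eq_zero.1 h6 with h5 | h5
      · by_contra hne
        exact H _ hj hne (by linarith)
      · linarith
  · induction hij using Nat.decreasingInduction with
    | self => simp
    | of_succ j hij ih =>
      obtain ⟨ih1, ih2⟩ := ih (by omega)
      have e : 2 * a i * (b i - b j) + transportPotential a b j -
          transportPotential a b i = (2 * a i * (b i - b (j + 1)) + transportPotential a b (j + 1) -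
          transportPotential a b i) + ((a j - a i) + (a (j + 1) - a i)) * (b j - b (j + 1)) := by
        rw [transportPotential.eq_1 a b (j + 1), Finset.sum_range_succ, ← transportPotential]; ring
      have h1 := ha j i (by omega) hi
      have h2 := ha (j + 1) i (by omega) hi
      have h3 := hb j (j + 1) (by omega) (by omega)
      have h4 : 0 ≤ ((a j - a i) + (a (j + 1) - a i)) * (b j - b (j + 1)) :=
        mul_nonneg (by linarith) (by linarith)
      rw [e]
      refine ⟨by linarith, fun H h => ?_⟩
      have hbj := ih2 H (by linarith)
      have h6 : ((a j - a i) + (a (j + 1) - a i)) * (b j - b (j + 1)) = 0 := by linarith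
      rcases mul_eq_zero.1 h6 with h5 | h5
      · by_contra hne
        exact H _ hj hne (by linarith)
      · linarith

/-- The rearrangement inequality for doubly stochastic matrices, and what equality says about the
support of the matrix. -/
theorem sum_mul_le_of_doublyStochastic {n : ℕ} {a b : Fin n → ℝ} (ha : Antitone a)
    (hb : Antitone b) {P : Fin n → Fin n → ℝ} (h0 : ∀ i j, 0 ≤ P i j)
    (hrow : ∀ i, ∑ j, P i j = 1) (hcol : ∀ j, ∑ i, P i j = 1) :
    ∑ i, ∑ j, P i j * (a i * b j) ≤ ∑ i, a i * b i ∧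
      (∑ i, ∑ j, P i j * (a i * b j) = ∑ i, a i * b i →
        ∀ i, (∀ k, b k ≠ b i → a k ≠ a i) → ∀ j, P i j ≠ 0 → b j = b i) := by
  -- The default 0 never matters: the potential at `j < n` reads indices up to `j` only.
  set a' : ℕ → ℝ := fun k => if h : k < n then a ⟨k, h⟩ else 0 with ha'
  set b' : ℕ → ℝ := fun k => if h : k < n then b ⟨k, h⟩ else 0 with hb'
  have ea : ∀ i : Fin n, a' i = a i := fun i => by simp [ha']
  have eb : ∀ i : Fin n, b' i = b i := fun i => by simp [hb']
  have gap := fun i j : Fin n => transportPotential_gap (a := a') (b := b') (n := n)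
    (fun k l hkl hl => by
      simpa [ha', hl, hkl.trans_lt hl] using ha (show (⟨k, hkl.trans_lt hl⟩ : Fin n) ≤ ⟨l, hl⟩ from hkl))
    (fun k l hkl hl => by
      simpa [hb', hl, hkl.trans_lt hl] using hb (show (⟨k, hkl.trans_lt hl⟩ : Fin n) ≤ ⟨l, hl⟩ from hkl))
    i.isLt j.isLt
  simp only [ea, eb] at gap
  set B : Fin n → ℝ := fun i => transportPotential a' b' i
  -- Averaged against `P`, the potentials cancel because rows and columns sum to 1. What remains is
  -- twice the defect in the inequality, so equality kills each gap on the support of `P`.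
  have hsum : ∑ i, ∑ j, P i j * (2 * a i * (b i - b j) + B j - B i) =
      2 * (∑ i, a i * b i - ∑ i, ∑ j, P i j * (a i * b j)) := by
    have e1 : ∑ i, ∑ j, P i j * B j = ∑ j, B j := by
      rw [Finset.sum_comm]
      exact Finset.sum_congr rfl fun j _ => by rw [← Finset.sum_mul, hcol, one_mul]
    have e2 : ∀ f : Fin n → ℝ, ∑ i, ∑ j, P i j * f i = ∑ i, f i := fun f =>
      Finset.sum_congr rfl fun i _ => by rw [← Finset.sum_mul, hrow, one_mul]
    have e3 : ∀ i j, P i j * (2 * a i * (b i - b j) + B j - B i) =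
        2 * (P i j * (a i * b i)) - 2 * (P i j * (a i * b j)) + P i j * B j - P i j * B i :=
      fun i j => by ring
    have e4 : ∑ i, ∑ j, 2 * (P i j * (a i * b i)) = 2 * ∑ i, a i * b i := by
      simp only [← Finset.mul_sum]
      rw [e2 fun i => a i * b i]
    have e5 : ∑ i, ∑ j, 2 * (P i j * (a i * b j)) = 2 * ∑ i, ∑ j, P i j * (a i * b j) := by
      simp only [← Finset.mul_sum]
    simp only [e3, Finset.sum_add_distrib, Finset.sum_sub_distrib]
    rw [e1, e2 B, e4, e5]
    ring
  have hnn : ∀ i j, 0 ≤ P i j * (2 * a i * (b i - b j) + B j - B i) := fun i j =>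
    mul_nonneg (h0 i j) (gap i j).1
  refine ⟨?_, fun heq i H j hP => ?_⟩
  · have := Finset.sum_nonneg fun i (_ : i ∈ Finset.univ) =>
      Finset.sum_nonneg fun j (_ : j ∈ Finset.univ) => hnn i j
    linarith
  · rw [heq, sub_self, mul_zero, Finset.sum_eq_zero_iff_of_nonneg fun i _ =>
      Finset.sum_nonneg fun j _ => hnn i j] at hsum
    have h1 := (Finset.sum_eq_zero_iff_of_nonneg fun j _ => hnn i j).1 (hsum i (Finset.mem_univ i)) j
      (Finset.mem_univ j)
    refine (gap i j).2 (fun k hk => ?_) ((mul_eq_zero.1 h1).resolve_left hP)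
    have := H ⟨k, hk⟩
    rwa [← ea ⟨k, hk⟩, ← eb ⟨k, hk⟩] at this

end Rearrangement

/-! ### Orthogonal diagonalization and the trace inequality. -/

section Spectral

variable {n : ℕ}

theorem eigDesc_antitone {M : Matrix (Fin n) (Fin n) ℝ} (hM : M.IsHermitian) :
    Antitone (eigDesc hM) := fun _ _ hij => hM.eigenvalues₀_antitone hij

theorem eigAsc_monotone {M : Matrix (Fin n) (Fin n) ℝ} (hM : M.IsHermitian) :
    Monotone (eigAsc hM) := fun _ _ hij => eigDesc_antitone hM (Fin.rev_le_rev.2 hij)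

/-- `M` is diagonalized by the orthogonal matrix `Q`, with eigenvalues `l`. -/
structure IsDiagonalization (M Q : Matrix (Fin n) (Fin n) ℝ) (l : Fin n → ℝ) : Prop where
  transpose_mul_self : Qᵀ * Q = 1
  mul_transpose_self : Q * Qᵀ = 1
  eq : M = Q * diagonal l * Qᵀ

theorem IsDiagonalization.reindex {M Q : Matrix (Fin n) (Fin n) ℝ} {l : Fin n → ℝ}
    (h : IsDiagonalization M Q l) (τ : Fin n ≃ Fin n) :
    IsDiagonalization M (Q.submatrix id τ) (l ∘ τ) where
  transpose_mul_self := by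
    rw [transpose_submatrix, ← submatrix_mul _ _ τ id τ Function.bijective_id, h.transpose_mul_self, submatrix_one_equiv]
  mul_transpose_self := by
    rw [transpose_submatrix, submatrix_mul_equiv, h.mul_transpose_self, submatrix_id_id]
  eq := by
    rw [← submatrix_diagonal_equiv, transpose_submatrix, submatrix_mul_equiv, submatrix_mul_equiv, ← h.eq, submatrix_id_id]

theorem exists_isDiagonalization_eigDesc {M : Matrix (Fin n) (Fin n) ℝ} (hM : M.IsHermitian) :
    ∃ Q, IsDiagonalization M Q (eigDesc hM) := by
  have h : IsDiagonalization M hM.eigenvectorUnitary hM.eigenvalues :=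
    { transpose_mul_self := by
        simpa [star_eq_conjTranspose] using Unitary.coe_star_mul_self hM.eigenvectorUnitary
      mul_transpose_self := by
        simpa [star_eq_conjTranspose] using Unitary.coe_mul_star_self hM.eigenvectorUnitary
      eq := by
        have := hM.spectral_theorem
        simpa [Unitary.conjStarAlgAut_apply, star_eq_conjTranspose] using this }
  -- `eigenvalues` is `eigenvalues₀` transported along an unspecified bijection; `τ` undoes it to
  -- recover the sorted order.
  let τ : Fin n ≃ Fin n := (finCongr (Fintype.card_fin n).symm).trans
    (Fintype.equivOfCardEq (Fintype.card_fin _))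
  have hτ : eigDesc hM = hM.eigenvalues ∘ τ := by
    funext i
    simp [τ, IsHermitian.eigenvalues, eigDesc]
  exact ⟨_, hτ ▸ h.reindex τ⟩

theorem exists_isDiagonalization_eigAsc {M : Matrix (Fin n) (Fin n) ℝ} (hM : M.IsHermitian) :
    ∃ Q, IsDiagonalization M Q (eigAsc hM) :=
  let ⟨_, h⟩ := exists_isDiagonalization_eigDesc hM
  ⟨_, h.reindex Fin.revPerm⟩

namespace IsDiagonalization

variable {M Q : Matrix (Fin n) (Fin n) ℝ} {l : Fin n → ℝ}

theorem isUnit_det (h : IsDiagonalization M Q l) : IsUnit Q.det :=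
  isUnit_det_of_left_inverse h.transpose_mul_self

theorem rank (h : IsDiagonalization M Q l) : M.rank = Fintype.card {i // l i ≠ 0} := by
  rw [h.eq, rank_mul_eq_left_of_isUnit_det _ _ (by rw [det_transpose]; exact h.isUnit_det),
    rank_mul_eq_right_of_isUnit_det _ _ h.isUnit_det, rank_diagonal]

theorem trace (h : IsDiagonalization M Q l) : M.trace = ∑ i, l i := by
  rw [h.eq, trace_mul_comm, ← Matrix.mul_assoc, h.transpose_mul_self, Matrix.one_mul, trace_diagonal]

theorem det (h : IsDiagonalization M Q l) : M.det = ∏ i, l i := by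
  rw [h.eq, det_mul, det_mul, mul_right_comm, ← det_mul, h.mul_transpose_self, det_one, one_mul,
    det_diagonal]

theorem add_smul_one (h : IsDiagonalization M Q l) (c : ℝ) :
    IsDiagonalization (M + c • (1 : Matrix (Fin n) (Fin n) ℝ)) Q fun i => l i + c where
  transpose_mul_self := h.transpose_mul_self
  mul_transpose_self := h.mul_transpose_self
  eq := by
    have : diagonal (fun i => l i + c) = diagonal l + c • (1 : Matrix (Fin n) (Fin n) ℝ) := by
      ext i j; by_cases hij : i = j <;> simp [hij, one_apply]
    rw [this, Matrix.mul_add, Matrix.add_mul, ← h.eq, Matrix.mul_smul, Matrix.smul_mul,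
      Matrix.mul_one, h.mul_transpose_self]

theorem neg (h : IsDiagonalization M Q l) : IsDiagonalization (-M) Q (-l) where
  transpose_mul_self := h.transpose_mul_self
  mul_transpose_self := h.mul_transpose_self
  eq := by
    rw [h.eq, show diagonal (-l) = -diagonal l from (diagonal_neg l).symm, Matrix.mul_neg,
      Matrix.neg_mul]

theorem inv (h : IsDiagonalization M Q l) (hl : ∀ i, l i ≠ 0) :
    IsDiagonalization M⁻¹ Q l⁻¹ where
  transpose_mul_self := h.transpose_mul_self
  mul_transpose_self := h.mul_transpose_self
  eq := by
    refine inv_eq_right_inv ?_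
    have : diagonal l * diagonal l⁻¹ = (1 : Matrix (Fin n) (Fin n) ℝ) := by
      rw [diagonal_mul_diagonal, ← diagonal_one]; congr 1; funext i; exact mul_inv_cancel₀ (hl i)
    calc M * (Q * diagonal l⁻¹ * Qᵀ) = Q * diagonal l * (Qᵀ * Q) * diagonal l⁻¹ * Qᵀ := by
          rw [h.eq]; simp only [Matrix.mul_assoc]
      _ = 1 := by
          rw [h.transpose_mul_self, Matrix.mul_one, Matrix.mul_assoc Q, this, Matrix.mul_one,
            h.mul_transpose_self]

theorem mul_eq (h : IsDiagonalization M Q l) : M * Q = Q * diagonal l := by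
  rw [h.eq, Matrix.mul_assoc, h.transpose_mul_self, Matrix.mul_one]

theorem nonneg_of_posSemidef (h : IsDiagonalization M Q l) (hM : M.PosSemidef) (i : Fin n) :
    0 ≤ l i := by
  have h1 : (Qᵀ * M * Q).PosSemidef := by simpa using hM.conjTranspose_mul_mul_same Q
  rw [Matrix.mul_assoc, h.mul_eq, ← Matrix.mul_assoc, h.transpose_mul_self, Matrix.one_mul] at h1
  simpa using h1.diag_nonneg (i := i)

theorem pos_of_posDef (h : IsDiagonalization M Q l) (hM : M.PosDef) (i : Fin n) : 0 < l i := by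
  refine lt_of_le_of_ne (h.nonneg_of_posSemidef hM.posSemidef i) fun h0 => hM.det_pos.ne' ?_
  rw [h.det]; exact Finset.prod_eq_zero (Finset.mem_univ i) h0.symm

/-- **Von Neumann's trace inequality** for symmetric matrices, and what equality says about
eigenvectors. -/
theorem trace_mul_le {N W : Matrix (Fin n) (Fin n) ℝ} {a : Fin n → ℝ}
    (hN : IsDiagonalization N W a) (hM : IsDiagonalization M Q l) (ha : Antitone a)
    (hl : Antitone l) :
    (N * M).trace ≤ ∑ i, a i * l i ∧ ((N * M).trace = ∑ i, a i * l i →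
      ∀ i, (∀ k, l k ≠ l i → a k ≠ a i) → ∀ r, (M * W) r i = W r i * l i) := by
  -- The squared entries of this orthogonal matrix form a doubly stochastic matrix, and the trace is
  -- their pairing with `a i * l j`.
  set O := Wᵀ * Q with hO
  have hO1 : O * Oᵀ = 1 := by
    rw [hO, transpose_mul, transpose_transpose, Matrix.mul_assoc, ← Matrix.mul_assoc Q,
      hM.mul_transpose_self, Matrix.one_mul, hN.transpose_mul_self]
  have hO2 : Oᵀ * O = 1 := by
    rw [hO, transpose_mul, transpose_transpose, Matrix.mul_assoc, ← Matrix.mul_assoc W,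
      hN.mul_transpose_self, Matrix.one_mul, hM.transpose_mul_self]
  have htr : (N * M).trace = ∑ i, ∑ j, O i j ^ 2 * (a i * l j) := by
    have : N * M = W * (diagonal a * O * diagonal l * Qᵀ) := by
      rw [hN.eq, hM.eq, hO]; simp only [Matrix.mul_assoc]
    rw [this, trace_mul_comm, Matrix.mul_assoc _ Qᵀ, show Qᵀ * W = Oᵀ by
      rw [hO, transpose_mul, transpose_transpose]]
    simp only [Matrix.trace, diag_apply, mul_apply (N := Oᵀ), mul_diagonal, diagonal_mul,
      transpose_apply]
    exact Finset.sum_congr rfl fun i _ => Finset.sum_congr rfl fun j _ => by ring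
  have key := sum_mul_le_of_doublyStochastic ha hl (P := fun i j => O i j ^ 2)
    (fun i j => sq_nonneg _)
    (fun i => by
      have := congrFun (congrFun hO1 i) i
      simpa [mul_apply, pow_two] using this)
    (fun j => by
      have := congrFun (congrFun hO2 j) j
      simpa [mul_apply, pow_two] using this)
  rw [htr]
  refine ⟨key.1, fun heq i H r => ?_⟩
  have hz := key.2 heq i H
  have h1 : M * W = Q * (diagonal l * Oᵀ) := by
    rw [hM.eq, hO, transpose_mul, transpose_transpose]; simp only [Matrix.mul_assoc]
  have h2 : W = Q * Oᵀ := by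
    rw [hO, transpose_mul, transpose_transpose, ← Matrix.mul_assoc, hM.mul_transpose_self, Matrix.one_mul]
  rw [h1]
  conv_rhs => rw [h2]
  simp only [mul_apply (M := Q), diagonal_mul, transpose_apply, Finset.sum_mul]
  refine Finset.sum_congr rfl fun j _ => ?_
  -- Column `i` of `W` combines columns `j` of `Q` with coefficients `O i j`; in the equality case
  -- only those with `l j = l i` occur.
  by_cases h0 : O i j = 0
  · simp [h0]
  · rw [hz j (pow_ne_zero 2 h0)]; ring

end IsDiagonalization

end Spectral

/-! ### Rank and vanishing eigenvalues. -/

section Rank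

variable {n : ℕ}

theorem eq_zero_of_card_ne_zero_le {l : Fin n → ℝ} (hl : Antitone l) (h0 : ∀ i, 0 ≤ l i) {k : ℕ}
    (hk : Fintype.card {i // l i ≠ 0} ≤ k) (i : Fin n) (hi : k ≤ i) : l i = 0 := by
  by_contra hne
  have hpos : 0 < l i := lt_of_le_of_ne (h0 i) (Ne.symm hne)
  have hsub : Finset.Iic i ⊆ Finset.univ.filter fun j => l j ≠ 0 := fun j hj => by
    simp only [Finset.mem_filter, Finset.mem_univ, true_and]
    exact (hpos.trans_le (hl (Finset.mem_Iic.1 hj))).ne'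
  have := Finset.card_le_card hsub
  rw [Fin.card_Iic, ← Fintype.card_subtype] at this
  omega

theorem pos_of_lt_card_ne_zero {l : Fin n → ℝ} (hl : Antitone l) (h0 : ∀ i, 0 ≤ l i) {k : ℕ}
    (hk : k < Fintype.card {i // l i ≠ 0}) (i : Fin n) (hi : i ≤ k) : 0 < l i := by
  refine lt_of_le_of_ne (h0 i) fun h => ?_
  have hsub : (Finset.univ.filter fun j => l j ≠ 0) ⊆ Finset.Iio i := fun j hj => by
    rw [Finset.mem_Iio]
    by_contra hij
    simp only [Finset.mem_filter, Finset.mem_univ, true_and] at hj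
    exact hj (le_antisymm (h ▸ hl (not_lt.1 hij)) (h0 j))
  have := Finset.card_le_card hsub
  rw [Fin.card_Iio, ← Fintype.card_subtype] at this
  omega

/-- Places the observation in the support of the Wishart laws. The factor is `Q` times a rectangular
diagonal matrix of square roots; the rank bound makes the eigenvalues that do not fit into `d`
columns zero. -/
theorem exists_colMatrix_mul_transpose_eq {S : Matrix (Fin n) (Fin n) ℝ} (hS : S.PosSemidef)
    {d : ℕ} (hd : S.rank ≤ d) {c : ℝ} (hc : 0 ≤ c) :
    ∃ f : Fin d → EuclideanSpace ℝ (Fin n), colMatrix f * (colMatrix f)ᵀ = c • S := by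
  obtain ⟨Q, hQ⟩ := exists_isDiagonalization_eigDesc hS.isHermitian
  set l := eigDesc hS.isHermitian
  have h0 := hQ.nonneg_of_posSemidef hS
  have hz := eq_zero_of_card_ne_zero_le (eigDesc_antitone hS.isHermitian) h0 (hQ.rank ▸ hd)
  let E : Matrix (Fin n) (Fin d) ℝ := of fun i k => if (i : ℕ) = k then √(c * l i) else 0
  have hE : E * Eᵀ = c • diagonal l := by
    ext i j
    simp only [mul_apply, transpose_apply, E, of_apply, Matrix.smul_apply, smul_eq_mul]
    by_cases hij : i = j
    · subst hij
      rw [diagonal_apply_eq]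
      by_cases hi : (i : ℕ) < d
      · rw [Finset.sum_eq_single ⟨i, hi⟩]
        · simp [Real.mul_self_sqrt (mul_nonneg hc (h0 i))]
        · intro k _ hk
          rw [if_neg fun h => hk (Fin.ext h.symm), zero_mul]
        · simp
      · rw [show l i = 0 from hz i (not_lt.1 hi), mul_zero]
        exact Finset.sum_eq_zero fun k _ => by rw [if_neg (by omega), zero_mul]
    · rw [diagonal_apply_ne _ hij, mul_zero]
      refine Finset.sum_eq_zero fun k _ => ?_
      by_cases hik : (i : ℕ) = k
      · rw [if_neg (c := (j : ℕ) = k) fun h => hij (Fin.ext (hik.trans h.symm)), mul_zero]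
      · rw [if_neg hik, zero_mul]
  refine ⟨fun k => WithLp.toLp 2 fun i => (Q * E) i k, ?_⟩
  change (Q * E) * (Q * E)ᵀ = _
  rw [transpose_mul, ← Matrix.mul_assoc, Matrix.mul_assoc Q E, hE, Matrix.mul_smul,
    Matrix.smul_mul, ← hQ.eq]

/-- The Gram matrix `X Xᵀ` of a matrix with `q` columns has at most `q` nonzero eigenvalues. -/
theorem exists_isDiagonalization_mul_transpose {q : ℕ} (X : Matrix (Fin n) (Fin q) ℝ) :
    ∃ W m, IsDiagonalization (X * Xᵀ) W m ∧ Antitone m ∧ (∀ i, 0 ≤ m i) ∧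
      ∀ i : Fin n, q ≤ i → m i = 0 := by
  have hX : (X * Xᵀ).PosSemidef := by simpa using posSemidef_self_mul_conjTranspose X
  obtain ⟨W, hW⟩ := exists_isDiagonalization_eigDesc hX.isHermitian
  have h0 := hW.nonneg_of_posSemidef hX
  refine ⟨W, _, hW, eigDesc_antitone _, h0,
    eq_zero_of_card_ne_zero_le (eigDesc_antitone _) h0 ?_⟩
  rw [← hW.rank]
  exact (rank_mul_le_left X Xᵀ).trans ((rank_le_width X))

end Rank

/-! ### Recovering a matrix from its Gram matrix. -/

section Gram

variable {n q : ℕ}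

/-- Two matrices with the same Gram matrix of rows differ by an orthogonal factor. -/
theorem exists_orthogonal_of_mul_transpose_eq {X Y : Matrix (Fin n) (Fin q) ℝ}
    (h : X * Xᵀ = Y * Yᵀ) : ∃ R ∈ orthogonalGroup (Fin q) ℝ, X = Y * Rᵀ := by
  let f := toEuclideanLin (𝕜 := ℝ) Yᵀ
  let g := toEuclideanLin (𝕜 := ℝ) Xᵀ
  have hsq : ∀ (Z : Matrix (Fin n) (Fin q) ℝ) (v : EuclideanSpace ℝ (Fin n)),
      ‖toEuclideanLin (𝕜 := ℝ) Zᵀ v‖ ^ 2 = v.ofLp ⬝ᵥ (Z * Zᵀ) *ᵥ v.ofLp := fun Z v => by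
    rw [← real_inner_self_eq_norm_sq, EuclideanSpace.inner_eq_star_dotProduct]
    simp [toLpLin_apply, ← mulVec_mulVec, dotProduct_mulVec, mulVec_transpose]
  have hnorm : ∀ v, ‖g v‖ = ‖f v‖ := fun v => by
    rw [← sq_eq_sq₀ (norm_nonneg _) (norm_nonneg _), hsq, hsq, h]
  obtain ⟨s, hs⟩ := f.rangeRestrict.exists_rightInverse_of_surjective f.range_rangeRestrict
  have hfs : ∀ w, f (s w) = w := fun w => congrArg Subtype.val (LinearMap.congr_fun hs w)
  -- Equal Gram matrices make `Yᵀ v ↦ Xᵀ v` a well-defined isometry on the range of `Yᵀ`; it extends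
  -- to the whole space.
  let L : LinearMap.range f →ₗᵢ[ℝ] EuclideanSpace ℝ (Fin q) :=
    ⟨g ∘ₗ s, fun w => by rw [LinearMap.comp_apply, hnorm, hfs]; rfl⟩
  have hL : ∀ v, L.extend (f v) = g v := fun v => by
    rw [show f v = (⟨f v, v, rfl⟩ : LinearMap.range f) from rfl, LinearIsometry.extend_apply]
    change g (s _) = g v
    rw [← sub_eq_zero, ← map_sub, ← norm_eq_zero, hnorm, map_sub, hfs, sub_self, norm_zero]
  let R : Matrix (Fin q) (Fin q) ℝ := (toEuclideanLin (𝕜 := ℝ)).symm L.extend.toLinearMap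
  have hR : toEuclideanLin (𝕜 := ℝ) R = L.extend.toLinearMap := LinearEquiv.apply_symm_apply _ _
  have hRv : ∀ v, R *ᵥ v = (L.extend (WithLp.toLp 2 v)).ofLp := fun v => by
    have := LinearMap.congr_fun hR (WithLp.toLp 2 v)
    exact congrArg WithLp.ofLp this
  refine ⟨R, ?_, ?_⟩
  · rw [mem_orthogonalGroup_iff']
    ext i j
    have h1 := L.extend.inner_map_map (EuclideanSpace.single i 1) (EuclideanSpace.single j 1)
    rw [EuclideanSpace.inner_eq_star_dotProduct] at h1
    have h2 : ∀ i, (L.extend (EuclideanSpace.single i (1 : ℝ))).ofLp = R.col i := fun i => by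
      rw [← mulVec_single_one, hRv]; rfl
    rw [h2, h2] at h1
    simp only [star_trivial] at h1
    rw [mul_apply]
    simp only [transpose_apply]
    simp only [dotProduct, col_apply] at h1
    rw [Finset.sum_congr rfl fun k _ => mul_comm (R k i) (R k j), h1]
    rw [EuclideanSpace.inner_single_left]
    simp [one_apply]
  · have h1 : R * Yᵀ = Xᵀ := by
      refine ext_of_mulVec_single fun i => ?_
      rw [← mulVec_mulVec, hRv]
      have := hL (WithLp.toLp 2 (Pi.single i 1))
      exact congrArg WithLp.ofLp this
    rw [← transpose_transpose X, ← h1, transpose_mul, transpose_transpose]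

/-- Eliminates `R`: the loss sees `X` only through `X Xᵀ`, so the estimates are best described in
those terms. -/
theorem exists_eq_mul_sqrt_mul_iff {U X : Matrix (Fin n) (Fin q) ℝ} {e : Fin q → ℝ}
    (he : ∀ j, 0 ≤ e j) :
    (∃ R ∈ orthogonalGroup (Fin q) ℝ, X = U * diagonal (fun j => √(e j)) * Rᵀ) ↔
      X * Xᵀ = U * diagonal e * Uᵀ := by
  have hsq : U * diagonal (fun j => √(e j)) * (U * diagonal (fun j => √(e j)))ᵀ =
      U * diagonal e * Uᵀ := by
    rw [transpose_mul, diagonal_transpose, Matrix.mul_assoc, ← Matrix.mul_assoc (diagonal _),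
      diagonal_mul_diagonal, ← Matrix.mul_assoc]
    simp only [Real.mul_self_sqrt (he _)]
  constructor
  · rintro ⟨R, hR, rfl⟩
    rw [mem_orthogonalGroup_iff'] at hR
    rw [transpose_mul, transpose_transpose, Matrix.mul_assoc, ← Matrix.mul_assoc Rᵀ, hR,
      Matrix.one_mul, hsq]
  · intro h
    exact exists_orthogonal_of_mul_transpose_eq (h.trans hsq.symm)

end Gram

/-! ### Trace, determinant and inverse of a low-rank matrix plus a scalar. -/

section LowRankUpdate

variable {n q : ℕ} {U : Matrix (Fin n) (Fin q) ℝ}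

theorem trace_mul_diagonal_mul_transpose_mul {S : Matrix (Fin n) (Fin n) ℝ} (hU : Uᵀ * U = 1)
    {l : Fin q → ℝ} (hS : S * U = U * diagonal l) (e : Fin q → ℝ) (c : ℝ) :
    ((U * diagonal e * Uᵀ + c • (1 : Matrix (Fin n) (Fin n) ℝ)) * S).trace =
      ∑ j, e j * l j + c * S.trace := by
  rw [Matrix.add_mul, trace_add, Matrix.smul_mul, Matrix.one_mul, trace_smul, smul_eq_mul,
    trace_mul_comm, ← Matrix.mul_assoc, ← Matrix.mul_assoc, hS, trace_mul_comm,
    ← Matrix.mul_assoc, ← Matrix.mul_assoc, hU, Matrix.one_mul, diagonal_mul_diagonal, trace_diagonal]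
  congr 1
  exact Finset.sum_congr rfl fun j _ => mul_comm _ _

/-- Sylvester's identity `det (1 + A B) = det (1 + B A)` reduces this to a diagonal `q × q`
determinant. -/
theorem log_det_low_rank_add_smul_one (hU : Uᵀ * U = 1) {e : Fin q → ℝ} {c : ℝ}
    (hc : 0 < c) (he : ∀ j, 0 < e j + c) :
    Real.log (U * diagonal e * Uᵀ + c • (1 : Matrix (Fin n) (Fin n) ℝ)).det =
      (n - q : ℝ) * Real.log c + ∑ j, Real.log (e j + c) := by
  have h1 : U * diagonal e * Uᵀ + c • (1 : Matrix (Fin n) (Fin n) ℝ) =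
      c • (1 + (c⁻¹ • (U * diagonal e)) * Uᵀ) := by
    rw [smul_add, Matrix.smul_mul, smul_inv_smul₀ hc.ne', add_comm]
  have h2 : (1 : Matrix (Fin q) (Fin q) ℝ) + Uᵀ * (c⁻¹ • (U * diagonal e)) =
      diagonal fun j => (e j + c) / c := by
    rw [Matrix.mul_smul, ← Matrix.mul_assoc, hU, Matrix.one_mul]
    ext i j
    by_cases hij : i = j
    · subst hij; simp [field]; ring
    · simp [hij]
  rw [h1, det_smul, det_one_add_mul_comm, h2, det_diagonal, Fintype.card_fin,
    Real.log_mul (pow_pos hc n).ne' (Finset.prod_pos fun j _ => div_pos (he j) hc).ne', Real.log_pow,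
    Real.log_prod fun j _ => (div_pos (he j) hc).ne']
  simp only [Real.log_div (he _).ne' hc.ne', Finset.sum_sub_distrib]
  simp
  ring

theorem inv_low_rank_add_smul_one (hU : Uᵀ * U = 1) {e : Fin q → ℝ} {c : ℝ}
    (hc : c ≠ 0) (he : ∀ j, e j + c ≠ 0) :
    (U * diagonal e * Uᵀ + c • (1 : Matrix (Fin n) (Fin n) ℝ))⁻¹ =
      U * diagonal (fun j => (e j + c)⁻¹ - c⁻¹) * Uᵀ + c⁻¹ • (1 : Matrix (Fin n) (Fin n) ℝ) := by
  refine inv_eq_right_inv ?_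
  set e' : Fin q → ℝ := fun j => (e j + c)⁻¹ - c⁻¹ with he'
  have h1 : U * diagonal e * Uᵀ * (U * diagonal e' * Uᵀ) = U * diagonal (fun j => e j * e' j) * Uᵀ := by
    rw [← diagonal_mul_diagonal]
    calc _ = U * diagonal e * (Uᵀ * U) * diagonal e' * Uᵀ := by simp only [Matrix.mul_assoc]
      _ = _ := by rw [hU, Matrix.mul_one]; simp only [Matrix.mul_assoc]
  have h2 : diagonal (fun j => e j * e' j) + c⁻¹ • diagonal e + c • diagonal e' = 0 := by
    ext i j
    by_cases hij : i = j
    · subst hij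
      have := he i
      simp only [he', Matrix.add_apply, Matrix.smul_apply, diagonal_apply_eq, smul_eq_mul, Matrix.zero_apply]
      field_simp
      ring
    · simp [hij]
  have h3 : U * (diagonal (fun j => e j * e' j) + c⁻¹ • diagonal e + c • diagonal e') * Uᵀ = 0 := by
    rw [h2, Matrix.mul_zero, Matrix.zero_mul]
  rw [Matrix.add_mul, Matrix.mul_add, Matrix.mul_add, h1, Matrix.mul_smul, Matrix.mul_one,
    Matrix.smul_mul, Matrix.one_mul, Matrix.smul_mul, Matrix.one_mul, smul_smul,
    mul_inv_cancel₀ hc, one_smul, ← add_assoc]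
  simp only [Matrix.mul_add, Matrix.add_mul, Matrix.mul_smul, Matrix.smul_mul] at h3
  rw [h3, zero_add]

end LowRankUpdate

/-! ### The scalar minimisation. -/

section Scalar

theorem log_add_one_le {l μ : ℝ} (hl : 0 < l) (hμ : 0 < μ) :
    Real.log l + 1 ≤ Real.log μ + l / μ := by
  have := Real.log_le_sub_one_of_pos (div_pos hl hμ)
  rw [Real.log_div hl.ne' hμ.ne'] at this
  linarith

theorem eq_of_log_add_div_eq {l μ : ℝ} (hl : 0 < l) (hμ : 0 < μ)
    (h : Real.log μ + l / μ = Real.log l + 1) : μ = l := by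
  by_contra hne
  have := Real.log_lt_sub_one_of_pos (div_pos hl hμ) fun h1 => hne ((div_eq_one_iff_eq hμ.ne').1 h1).symm
  rw [Real.log_div hl.ne' hμ.ne'] at this
  linarith

variable {n q : ℕ}

theorem sum_fin_eq_sum_castLE_add (hq : q ≤ n) (f : Fin n → ℝ) :
    ∑ i, f i = ∑ j : Fin q, f (Fin.castLE hq j) +
      ∑ i ∈ Finset.univ.filter (fun i : Fin n => q ≤ i.val), f i := by
  rw [← Finset.sum_filter_not_add_sum_filter Finset.univ (fun i : Fin n => q ≤ i.val)]
  congr 1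
  symm
  refine Finset.sum_bij (fun j _ => Fin.castLE hq j) ?_ ?_ ?_ fun _ _ => rfl
  · intro j _; simp
  · intro i _ j _ h; exact Fin.castLE_injective hq h
  · intro i hi
    simp only [Finset.mem_filter, Finset.mem_univ, true_and, not_le] at hi
    exact ⟨⟨i, hi⟩, Finset.mem_univ _, rfl⟩

theorem card_filter_le_val (hq : q ≤ n) :
    ((Finset.univ.filter fun i : Fin n => q ≤ i.val).card : ℝ) = n - q := by
  have := sum_fin_eq_sum_castLE_add hq fun _ => 1
  simp at this
  linarith

/-- The minimal value of the Wishart loss over scale matrices with `q` free eigenvalues, when the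
observation has eigenvalues `l` and those from the `q`-th on have mean `t`. -/
noncomputable def optimalLoss (hq : q ≤ n) (l : Fin n → ℝ) (t : ℝ) : ℝ :=
  ∑ j : Fin q, (Real.log (l (Fin.castLE hq j)) + 1) + (n - q) * (Real.log t + 1)

/-- Since `μ` is constant on the tail, the tail terms merge into `(n - q) * (log s + t / s)`, and
`log x ≤ x - 1` is applied to the mean `t` rather than to each `l i`. Individual tail eigenvalues
may thus be zero, as for singular observations. -/
theorem optimalLoss_le (hq : q < n) {l μ : Fin n → ℝ} {s t : ℝ}
    (hl : ∀ j : Fin q, 0 < l (Fin.castLE hq.le j)) (ht : 0 < t)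
    (hlt : ∑ i ∈ Finset.univ.filter (fun i : Fin n => q ≤ i.val), l i = (n - q) * t)
    (hμ : ∀ i, 0 < μ i) (hs : 0 < s) (hμs : ∀ i : Fin n, q ≤ i → μ i = s) :
    optimalLoss hq.le l t ≤ ∑ i, (Real.log (μ i) + l i / μ i) ∧
      (∑ i, (Real.log (μ i) + l i / μ i) = optimalLoss hq.le l t →
        s = t ∧ ∀ j : Fin q, μ (Fin.castLE hq.le j) = l (Fin.castLE hq.le j)) := by
  have hnq : (0 : ℝ) < n - q := by
    have : (q : ℝ) < n := by exact_mod_cast hq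
    linarith
  have e : ∑ i, (Real.log (μ i) + l i / μ i) =
      ∑ j : Fin q, (Real.log (μ (Fin.castLE hq.le j)) +
        l (Fin.castLE hq.le j) / μ (Fin.castLE hq.le j)) +
      (n - q) * (Real.log s + t / s) := by
    rw [sum_fin_eq_sum_castLE_add hq.le]
    congr 1
    rw [Finset.sum_congr rfl fun i hi => by rw [hμs i (by simpa using hi)],
      Finset.sum_add_distrib, ← Finset.sum_div, hlt, Finset.sum_const, nsmul_eq_mul,
      card_filter_le_val hq.le]
    ring
  have h1 : ∀ j : Fin q, Real.log (l (Fin.castLE hq.le j)) + 1 ≤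
      Real.log (μ (Fin.castLE hq.le j)) + l (Fin.castLE hq.le j) / μ (Fin.castLE hq.le j) :=
    fun j => log_add_one_le (hl j) (hμ _)
  have h1' := Finset.sum_le_sum fun j (_ : j ∈ Finset.univ) => h1 j
  have h2 := mul_le_mul_of_nonneg_left (log_add_one_le ht hs) hnq.le
  rw [e, optimalLoss]
  refine ⟨add_le_add h1' h2, fun h => ⟨?_, fun j => ?_⟩⟩
  · exact eq_of_log_add_div_eq ht hs (mul_left_cancel₀ hnq.ne' (by linarith))
  · have h3 := (Finset.sum_eq_sum_iff_of_le fun j (_ : j ∈ Finset.univ) => h1 j).1 (by linarith) j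
      (Finset.mem_univ j)
    exact eq_of_log_add_div_eq (hl j) (hμ _) h3.symm

end Scalar

/-! ### Lower bound for the loss and its equality case. -/

section Optimum

variable {n q : ℕ}

theorem mul_diagonal_mul_transpose_eq_submatrix (hq : q ≤ n) (W : Matrix (Fin n) (Fin n) ℝ)
    {m : Fin n → ℝ} (hm : ∀ i : Fin n, q ≤ i → m i = 0) :
    W * diagonal m * Wᵀ = W.submatrix id (Fin.castLE hq) *
      diagonal (fun j => m (Fin.castLE hq j)) * (W.submatrix id (Fin.castLE hq))ᵀ := by
  ext r c
  rw [mul_apply, mul_apply, sum_fin_eq_sum_castLE_add hq]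
  simp only [mul_diagonal, transpose_apply, submatrix_apply, id]
  rw [add_eq_left]
  refine Finset.sum_eq_zero fun i hi => ?_
  rw [hm i (by simpa using hi)]; ring

theorem isEigenvectors_submatrix_castLE (hq : q ≤ n) {S W : Matrix (Fin n) (Fin n) ℝ}
    (hW : Wᵀ * W = 1) {l : Fin n → ℝ}
    (h : ∀ (j : Fin q) r, (S * W) r (Fin.castLE hq j) = W r (Fin.castLE hq j) * l (Fin.castLE hq j)) :
    IsEigenvectors S (fun j => l (Fin.castLE hq j)) (W.submatrix id (Fin.castLE hq)) := by
  constructor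
  · rw [transpose_submatrix, ← submatrix_mul _ _ _ id _ Function.bijective_id, hW]
    exact submatrix_one _ (Fin.castLE_injective hq)
  · ext r j
    rw [mul_diagonal]
    exact h j r

theorem IsDiagonalization.isEigenvectors {S Q : Matrix (Fin n) (Fin n) ℝ} {l : Fin n → ℝ}
    (h : IsDiagonalization S Q l) (hq : q ≤ n) :
    IsEigenvectors S (fun j => l (Fin.castLE hq j)) (Q.submatrix id (Fin.castLE hq)) :=
  isEigenvectors_submatrix_castLE hq h.transpose_mul_self fun j r => by
    rw [h.mul_eq, mul_diagonal]

/-- Numbers all on one side of their mean equal it. This settles the case where a leading eigenvalue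
ties with the tail mean. -/
theorem eq_of_sum_eq_card_mul {l : Fin n → ℝ} {t : ℝ} (hq : q ≤ n)
    (hlt : ∑ i ∈ Finset.univ.filter (fun i : Fin n => q ≤ i.val), l i = (n - q) * t)
    (h : (∀ i : Fin n, q ≤ i → l i ≤ t) ∨ ∀ i : Fin n, q ≤ i → t ≤ l i) (i : Fin n) (hi : q ≤ i) :
    l i = t := by
  have hc : ∑ i ∈ Finset.univ.filter (fun i : Fin n => q ≤ i.val), t = (n - q) * t := by
    rw [Finset.sum_const, nsmul_eq_mul, card_filter_le_val hq]
  have hi' : i ∈ Finset.univ.filter (fun i : Fin n => q ≤ i.val) := by simpa using hi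
  rcases h with h | h
  · exact (Finset.sum_eq_sum_iff_of_le fun i hi => h i (by simpa using hi)).1 (hlt.trans hc.symm) i hi'
  · exact ((Finset.sum_eq_sum_iff_of_le fun i hi => h i (by simpa using hi)).1 (hc.trans hlt.symm) i
      hi').symm

theorem optimalLoss_le_wishartLoss_major (hq : q < n) {S Q : Matrix (Fin n) (Fin n) ℝ}
    {l : Fin n → ℝ} {t : ℝ} (hS : IsDiagonalization S Q l) (hl : Antitone l)
    (hl0 : ∀ j : Fin q, 0 < l (Fin.castLE hq.le j)) (ht : 0 < t)
    (hlt : ∑ i ∈ Finset.univ.filter (fun i : Fin n => q ≤ i.val), l i = (n - q) * t)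
    (X : Matrix (Fin n) (Fin q) ℝ) {s : ℝ} (hs : 0 < s) :
    optimalLoss hq.le l t ≤ wishartLoss S (X * Xᵀ + s • (1 : Matrix (Fin n) (Fin n) ℝ)) ∧
      (wishartLoss S (X * Xᵀ + s • (1 : Matrix (Fin n) (Fin n) ℝ)) = optimalLoss hq.le l t →
        s = t ∧ ∃ U, IsEigenvectors S (fun j => l (Fin.castLE hq.le j)) U ∧
          X * Xᵀ = U * diagonal (fun j => l (Fin.castLE hq.le j) - t) * Uᵀ) := by
  obtain ⟨W, m, hX, hm, hm0, hmq⟩ := exists_isDiagonalization_mul_transpose X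
  have hμ : ∀ i, 0 < m i + s := fun i => add_pos_of_nonneg_of_pos (hm0 i) hs
  have hV := hX.add_smul_one s
  -- The sign makes the eigenvalues decrease in the same order as those of `S`, turning the upper
  -- bound on a trace into a lower bound for `tr (V⁻¹ S)`.
  have hN := (hV.inv fun i => (hμ i).ne').neg
  have ha : Antitone (-(fun i => m i + s)⁻¹) := fun i j hij => by
    simp only [Pi.neg_apply, Pi.inv_apply, neg_le_neg_iff]
    exact inv_anti₀ (hμ j) (by linarith [hm hij])
  have htr := hN.trace_mul_le hS ha hl
  have hopt := optimalLoss_le hq hl0 ht hlt hμ hs fun i hi => by rw [hmq i hi, zero_add]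
  have e1 : ∑ i, (-(fun i => m i + s)⁻¹) i * l i = -∑ i, l i / (m i + s) := by
    rw [← Finset.sum_neg_distrib]
    exact Finset.sum_congr rfl fun i _ => by
      simp only [Pi.neg_apply, Pi.inv_apply]; rw [div_eq_mul_inv]; ring
  have e2 : wishartLoss S (X * Xᵀ + s • (1 : Matrix (Fin n) (Fin n) ℝ)) =
      ∑ i, Real.log (m i + s) - (-(X * Xᵀ + s • (1 : Matrix (Fin n) (Fin n) ℝ))⁻¹ * S).trace := by
    rw [wishartLoss, hV.det, Real.log_prod fun i _ => (hμ i).ne', Matrix.neg_mul, trace_neg, sub_neg_eq_add]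
  rw [Finset.sum_add_distrib] at hopt
  rw [e1] at htr
  rw [e2]
  refine ⟨by linarith [htr.1, hopt.1], fun h => ?_⟩
  obtain ⟨hst, hml⟩ := hopt.2 (by linarith [htr.1, hopt.1])
  have hvec := htr.2 (by linarith [htr.1, hopt.1])
  subst hst
  refine ⟨rfl, W.submatrix id (Fin.castLE hq.le),
    isEigenvectors_submatrix_castLE hq.le hX.transpose_mul_self fun j r =>
      hvec _ (fun k hk hak => hk ?_) r, ?_⟩
  -- Equal eigenvalues of `V` must come from equal eigenvalues of `S`. A tail index `k` can tie with
  -- `j < q` only if `l j = t`; then the tail lies below its mean and is constant.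
  · have hmk : m k = m (Fin.castLE hq.le j) := by
      simpa using hak
    by_cases hkq : (k : ℕ) < q
    · have := hml ⟨k, hkq⟩
      rw [← hml j, ← hmk]
      exact this.symm
    · rw [hmq k (not_lt.1 hkq)] at hmk
      have h1 := hml j
      rw [← hmk, zero_add] at h1
      rw [← h1]
      refine eq_of_sum_eq_card_mul hq.le hlt (Or.inl fun i hi => ?_) k (not_lt.1 hkq)
      rw [h1]
      exact hl (Fin.le_def.2 (j.isLt.le.trans hi))
  · rw [hX.eq, mul_diagonal_mul_transpose_eq_submatrix hq.le W hmq]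
    simp only [← hml, add_sub_cancel_right]

theorem optimalLoss_le_wishartLoss_minor (hq : q < n) {G Q : Matrix (Fin n) (Fin n) ℝ}
    {l : Fin n → ℝ} {t : ℝ} (hG : IsDiagonalization G Q l) (hl : Monotone l)
    (hl0 : ∀ j : Fin q, 0 < l (Fin.castLE hq.le j)) (ht : 0 < t)
    (hlt : ∑ i ∈ Finset.univ.filter (fun i : Fin n => q ≤ i.val), l i = (n - q) * t)
    (X : Matrix (Fin n) (Fin q) ℝ) {b : ℝ} (hb : 0 < b) :
    optimalLoss hq.le l t ≤ wishartLoss G (X * Xᵀ + b • (1 : Matrix (Fin n) (Fin n) ℝ))⁻¹ ∧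
      (wishartLoss G (X * Xᵀ + b • (1 : Matrix (Fin n) (Fin n) ℝ))⁻¹ = optimalLoss hq.le l t →
        b = t⁻¹ ∧ ∃ U, IsEigenvectors G (fun j => l (Fin.castLE hq.le j)) U ∧
          X * Xᵀ = U * diagonal (fun j => (l (Fin.castLE hq.le j))⁻¹ - t⁻¹) * Uᵀ) := by
  obtain ⟨W, m, hX, hm, hm0, hmq⟩ := exists_isDiagonalization_mul_transpose X
  have hμ : ∀ i, 0 < m i + b := fun i => add_pos_of_nonneg_of_pos (hm0 i) hb
  have hK := hX.add_smul_one b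
  have ha : Antitone fun i => m i + b := fun i j hij => by
    have := hm hij; simp only; linarith
  have htr := hK.trace_mul_le hG.neg ha hl.neg
  have hopt := optimalLoss_le (μ := fun i => (m i + b)⁻¹) hq hl0 ht hlt (fun i => inv_pos.2 (hμ i))
    (inv_pos.2 hb) fun i hi => by rw [hmq i hi, zero_add]
  have e1 : ∑ i, (m i + b) * (-l) i = -∑ i, l i / (m i + b)⁻¹ := by
    rw [← Finset.sum_neg_distrib]
    exact Finset.sum_congr rfl fun i _ => by
      simp only [Pi.neg_apply]; rw [div_inv_eq_mul]; ring
  have e2 : wishartLoss G (X * Xᵀ + b • (1 : Matrix (Fin n) (Fin n) ℝ))⁻¹ =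
      ∑ i, Real.log (m i + b)⁻¹ - ((X * Xᵀ + b • (1 : Matrix (Fin n) (Fin n) ℝ)) * -G).trace := by
    have hdet : IsUnit (X * Xᵀ + b • (1 : Matrix (Fin n) (Fin n) ℝ)).det := by
      rw [hK.det]; exact (Finset.prod_pos fun i _ => hμ i).ne'.isUnit
    rw [wishartLoss, nonsing_inv_nonsing_inv _ hdet, (hK.inv fun i => (hμ i).ne').det,
      Real.log_prod (f := (fun i => m i + b)⁻¹) fun i _ => inv_ne_zero (hμ i).ne', Matrix.mul_neg, trace_neg, sub_neg_eq_add]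
    rfl
  rw [Finset.sum_add_distrib] at hopt
  rw [e1] at htr
  rw [e2]
  refine ⟨by linarith [htr.1, hopt.1], fun h => ?_⟩
  obtain ⟨hbt, hml⟩ := hopt.2 (by linarith [htr.1, hopt.1])
  have hvec := htr.2 (by linarith [htr.1, hopt.1])
  subst hbt
  rw [inv_inv]
  have hml' : ∀ j : Fin q, m (Fin.castLE hq.le j) = (l (Fin.castLE hq.le j))⁻¹ - b := fun j => by
    rw [← hml j, inv_inv, add_sub_cancel_right]
  refine ⟨rfl, W.submatrix id (Fin.castLE hq.le),
    isEigenvectors_submatrix_castLE hq.le hX.transpose_mul_self fun j r => ?_, ?_⟩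
  · have h1 := hvec (Fin.castLE hq.le j) (fun k hk hak => hk ?_) r
    · simpa using h1
    have hmk : m k = m (Fin.castLE hq.le j) := by simpa using hak
    simp only [Pi.neg_apply, neg_inj]
    by_cases hkq : (k : ℕ) < q
    · rw [← hml j, ← hmk]
      exact (hml ⟨k, hkq⟩).symm
    · rw [hmq k (not_lt.1 hkq)] at hmk
      have h1 := hml j
      rw [← hmk, zero_add] at h1
      rw [← h1]
      refine eq_of_sum_eq_card_mul hq.le hlt (Or.inr fun i hi => ?_) k (not_lt.1 hkq)
      rw [h1]
      exact hl (Fin.le_def.2 (j.isLt.le.trans hi))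
  · rw [hX.eq, mul_diagonal_mul_transpose_eq_submatrix hq.le W hmq]
    simp only [hml']

/-- The trace term is `q + (n - q)`, and only `tr S` and the eigenvector equations for `U` enter, so
every choice of `U` within repeated eigenvalues attains the bound. -/
theorem wishartLoss_eq_optimalLoss (hq : q < n) {S : Matrix (Fin n) (Fin n) ℝ}
    {l : Fin n → ℝ} {t : ℝ} (htr : S.trace = ∑ i, l i)
    (hl0 : ∀ j : Fin q, 0 < l (Fin.castLE hq.le j)) (ht : 0 < t)
    (hlt : ∑ i ∈ Finset.univ.filter (fun i : Fin n => q ≤ i.val), l i = (n - q) * t)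
    {U : Matrix (Fin n) (Fin q) ℝ} (hU : IsEigenvectors S (fun j => l (Fin.castLE hq.le j)) U) :
    wishartLoss S (U * diagonal (fun j => l (Fin.castLE hq.le j) - t) * Uᵀ +
      t • (1 : Matrix (Fin n) (Fin n) ℝ)) = optimalLoss hq.le l t := by
  rw [wishartLoss, log_det_low_rank_add_smul_one hU.1 ht (by simpa using hl0),
    inv_low_rank_add_smul_one hU.1 ht.ne' (by simpa using fun j => (hl0 j).ne'),
    trace_mul_diagonal_mul_transpose_mul hU.1 hU.2, htr, sum_fin_eq_sum_castLE_add hq.le, hlt,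
    optimalLoss]
  simp only [sub_add_cancel, sub_mul, inv_mul_cancel₀ (hl0 _).ne', Finset.sum_sub_distrib,
    Finset.sum_add_distrib, ← Finset.mul_sum]
  field_simp
  ring

theorem forall_le_iff_of_forall_le {Θ : Type*} {F : Θ → ℝ} {C : ℝ} {p : Θ → Prop}
    (hle : ∀ θ, C ≤ F θ) (heq : ∀ θ, F θ = C ↔ p θ) (hex : ∃ θ, p θ) (θ : Θ) :
    (∀ θ', F θ ≤ F θ') ↔ p θ := by
  obtain ⟨θ₀, h₀⟩ := hex
  rw [← heq] at h₀ ⊢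
  exact ⟨fun h => le_antisymm (h₀ ▸ h θ₀) (hle θ), fun h θ' => h ▸ hle θ'⟩

theorem posDef_mul_transpose_add_smul_one (X : Matrix (Fin n) (Fin q) ℝ) {s : ℝ} (hs : 0 < s) :
    (X * Xᵀ + s • (1 : Matrix (Fin n) (Fin n) ℝ)).PosDef := by
  have hX : (X * Xᵀ).PosSemidef := by simpa using posSemidef_self_mul_conjTranspose X
  exact PosDef.posSemidef_add hX (PosDef.one.smul hs)

end Optimum

/-! ### The two families of MAP estimates. -/

section Estimates

variable {n q d : ℕ}

theorem isScaledMajor_iff (hq : q < n) {S : Matrix (Fin n) (Fin n) ℝ} (hS : S.IsHermitian) {t : ℝ}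
    (ht : ∀ j, t ≤ majorEig hq hS j) (X : Matrix (Fin n) (Fin q) ℝ) :
    IsScaledMajor hq hS t X ↔ ∃ U, IsEigenvectors S (majorEig hq hS) U ∧
      X * Xᵀ = U * diagonal (fun j => majorEig hq hS j - t) * Uᵀ := by
  refine exists_congr fun U => ?_
  rw [← exists_eq_mul_sqrt_mul_iff fun j => sub_nonneg.2 (ht j)]
  exact ⟨fun ⟨R, hR, hU, hX⟩ => ⟨hU, R, hR, hX⟩, fun ⟨hU, R, hR, hX⟩ => ⟨R, hR, hU, hX⟩⟩

theorem isScaledMinor_iff (hq : q < n) {G : Matrix (Fin n) (Fin n) ℝ} (hG : G.IsHermitian) {b : ℝ}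
    (hb : ∀ j, b ≤ (minorEig hq hG j)⁻¹) (X : Matrix (Fin n) (Fin q) ℝ) :
    IsScaledMinor hq hG b X ↔ ∃ U, IsEigenvectors G (minorEig hq hG) U ∧
      X * Xᵀ = U * diagonal (fun j => (minorEig hq hG j)⁻¹ - b) * Uᵀ := by
  refine exists_congr fun U => ?_
  rw [← exists_eq_mul_sqrt_mul_iff fun j => sub_nonneg.2 (hb j)]
  exact ⟨fun ⟨R, hR, hU, hX⟩ => ⟨hU, R, hR, hX⟩, fun ⟨hU, R, hR, hX⟩ => ⟨R, hR, hU, hX⟩⟩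

theorem exists_mul_transpose_eq {e : Fin q → ℝ} (he : ∀ j, 0 ≤ e j) (U : Matrix (Fin n) (Fin q) ℝ) :
    ∃ X : Matrix (Fin n) (Fin q) ℝ, X * Xᵀ = U * diagonal e * Uᵀ :=
  ⟨_, (exists_eq_mul_sqrt_mul_iff he).1 ⟨1, one_mem _, rfl⟩⟩

theorem isMAP_iff_isScaledMajor (hq : q < n) {S : Matrix (Fin n) (Fin n) ℝ} (hS : S.PosSemidef)
    (hqr : q < S.rank) (hrd : S.rank ≤ d) :
    0 < sigmaSqHat q hS.isHermitian ∧
      (∀ j : Fin q, sigmaSqHat q hS.isHermitian ≤ majorEig hq hS.isHermitian j) ∧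
      (∀ (X : Matrix (Fin n) (Fin q) ℝ) (s : Set.Ioi (0 : ℝ)),
        IsMAP (fun θ : Matrix (Fin n) (Fin q) ℝ × Set.Ioi (0 : ℝ) =>
            wishart (θ.1 * θ.1ᵀ + (θ.2 : ℝ) • (1 : Matrix (Fin n) (Fin n) ℝ)) d)
          (flatPrior (Matrix (Fin n) (Fin q) ℝ × Set.Ioi (0 : ℝ))) ((d : ℝ) • S) (X, s) ↔
        (s : ℝ) = sigmaSqHat q hS.isHermitian ∧
          IsScaledMajor hq hS.isHermitian (sigmaSqHat q hS.isHermitian) X) ∧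
      (∀ X : Matrix (Fin n) (Fin q) ℝ,
        IsMAP (fun X' : Matrix (Fin n) (Fin q) ℝ =>
            wishart (X' * X'ᵀ +
              sigmaSqHat q hS.isHermitian • (1 : Matrix (Fin n) (Fin n) ℝ)) d)
          (flatPrior (Matrix (Fin n) (Fin q) ℝ)) ((d : ℝ) • S) X ↔
        IsScaledMajor hq hS.isHermitian (sigmaSqHat q hS.isHermitian) X) := by
  obtain ⟨Q, hQ⟩ := exists_isDiagonalization_eigDesc hS.isHermitian
  have hd : 0 < d := by omega
  have hnq : (0 : ℝ) < n - q := sub_pos.2 (by exact_mod_cast hq)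
  have hl := eigDesc_antitone hS.isHermitian
  have h0 := hQ.nonneg_of_posSemidef hS
  have hpos := pos_of_lt_card_ne_zero hl h0 (hQ.rank ▸ hqr)
  have hl0 : ∀ j : Fin q, 0 < eigDesc hS.isHermitian (Fin.castLE hq.le j) := fun j =>
    hpos _ j.isLt.le
  have hlt : ∑ i ∈ Finset.univ.filter (fun i : Fin n => q ≤ i.val), eigDesc hS.isHermitian i =
      (n - q) * sigmaSqHat q hS.isHermitian := (mul_div_cancel₀ _ hnq.ne').symm
  -- Counting from 0, rank above `q` makes the eigenvalue with index `q` positive; it is the first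
  -- one in the tail sum.
  have ht : 0 < sigmaSqHat q hS.isHermitian := by
    refine div_pos (Finset.sum_pos' (fun i _ => h0 i) ⟨⟨q, hq⟩, by simp, hpos _ le_rfl⟩) hnq
  have hle : ∀ j : Fin q, sigmaSqHat q hS.isHermitian ≤ majorEig hq hS.isHermitian j := fun j => by
    rw [sigmaSqHat, div_le_iff₀ hnq, mul_comm, ← card_filter_le_val hq.le, ← nsmul_eq_mul]
    refine Finset.sum_le_card_nsmul _ _ _ fun i hi => hl (Fin.le_def.2 ?_)
    exact j.isLt.le.trans (by simpa using hi)
  set t := sigmaSqHat q hS.isHermitian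
  obtain ⟨f, hf⟩ := exists_colMatrix_mul_transpose_eq hS hrd d.cast_nonneg
  have hmin := fun (X : Matrix (Fin n) (Fin q) ℝ) (s : ℝ) (hs : 0 < s) =>
    optimalLoss_le_wishartLoss_major hq hQ hl hl0 ht hlt X hs
  have hval : ∀ X, IsScaledMajor hq hS.isHermitian t X →
      wishartLoss S (X * Xᵀ + t • (1 : Matrix (Fin n) (Fin n) ℝ)) = optimalLoss hq.le
        (eigDesc hS.isHermitian) t := fun X hX => by
    obtain ⟨U, hU, hXU⟩ := (isScaledMajor_iff hq hS.isHermitian hle X).1 hX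
    rw [hXU]
    exact wishartLoss_eq_optimalLoss hq hQ.trace hl0 ht hlt hU
  obtain ⟨X₀, hX₀⟩ : ∃ X, IsScaledMajor hq hS.isHermitian t X := by
    obtain ⟨X, hX⟩ := exists_mul_transpose_eq (fun j => sub_nonneg.2 (hle j))
      (Q.submatrix id (Fin.castLE hq.le))
    exact ⟨X, (isScaledMajor_iff hq hS.isHermitian hle X).2 ⟨_, hQ.isEigenvectors hq.le, hX⟩⟩
  refine ⟨ht, hle, fun X s => ?_, fun X => ?_⟩
  · refine (isMAP_wishart_iff (V := fun θ : Matrix (Fin n) (Fin q) ℝ × Set.Ioi (0 : ℝ) =>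
      θ.1 * θ.1ᵀ + (θ.2 : ℝ) • (1 : Matrix (Fin n) (Fin n) ℝ)) hd
      (fun θ => posDef_mul_transpose_add_smul_one θ.1 θ.2.2) hf
      (X, s)).trans ?_
    refine forall_le_iff_of_forall_le
      (p := fun θ : Matrix (Fin n) (Fin q) ℝ × Set.Ioi (0 : ℝ) => (θ.2 : ℝ) = t ∧
        IsScaledMajor hq hS.isHermitian t θ.1)
      (fun θ => (hmin θ.1 θ.2 θ.2.2).1) (fun θ => ⟨fun h => ?_, fun h => ?_⟩)
      ⟨(X₀, ⟨t, ht⟩), rfl, hX₀⟩ (X, s)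
    · have h1 := (hmin θ.1 θ.2 θ.2.2).2 h
      exact ⟨h1.1, (isScaledMajor_iff hq hS.isHermitian hle _).2 h1.2⟩
    · rw [h.1]; exact hval _ h.2
  · refine (isMAP_wishart_iff (V := fun X : Matrix (Fin n) (Fin q) ℝ =>
      X * Xᵀ + t • (1 : Matrix (Fin n) (Fin n) ℝ)) hd
      (fun X => posDef_mul_transpose_add_smul_one X ht) hf X).trans ?_
    refine forall_le_iff_of_forall_le (fun X => (hmin X t ht).1)
      (fun X => ⟨fun h => ?_, hval X⟩) ⟨X₀, hX₀⟩ X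
    exact (isScaledMajor_iff hq hS.isHermitian hle _).2 ((hmin X t ht).2 h).2

theorem isMAP_iff_isScaledMinor (hq : q < n) {G : Matrix (Fin n) (Fin n) ℝ} (hG : G.PosDef)
    (hnd : n ≤ d) :
    0 < betaHat q hG.isHermitian ∧
      (∀ j : Fin q, betaHat q hG.isHermitian ≤ (minorEig hq hG.isHermitian j)⁻¹) ∧
      (∀ (X : Matrix (Fin n) (Fin q) ℝ) (b : Set.Ioi (0 : ℝ)),
        IsMAP (fun θ : Matrix (Fin n) (Fin q) ℝ × Set.Ioi (0 : ℝ) =>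
            wishart (θ.1 * θ.1ᵀ + (θ.2 : ℝ) • (1 : Matrix (Fin n) (Fin n) ℝ))⁻¹ d)
          (flatPrior (Matrix (Fin n) (Fin q) ℝ × Set.Ioi (0 : ℝ))) ((d : ℝ) • G) (X, b) ↔
        (b : ℝ) = betaHat q hG.isHermitian ∧
          IsScaledMinor hq hG.isHermitian (betaHat q hG.isHermitian) X) ∧
      (∀ X : Matrix (Fin n) (Fin q) ℝ,
        IsMAP (fun X' : Matrix (Fin n) (Fin q) ℝ =>
            wishart (X' * X'ᵀ +
              betaHat q hG.isHermitian • (1 : Matrix (Fin n) (Fin n) ℝ))⁻¹ d)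
          (flatPrior (Matrix (Fin n) (Fin q) ℝ)) ((d : ℝ) • G) X ↔
        IsScaledMinor hq hG.isHermitian (betaHat q hG.isHermitian) X) := by
  obtain ⟨Q, hQ⟩ := exists_isDiagonalization_eigAsc hG.isHermitian
  have hd : 0 < d := by omega
  have hnq : (0 : ℝ) < n - q := sub_pos.2 (by exact_mod_cast hq)
  have hl := eigAsc_monotone hG.isHermitian
  have hpos := hQ.pos_of_posDef hG
  have hl0 : ∀ j : Fin q, 0 < eigAsc hG.isHermitian (Fin.castLE hq.le j) := fun j => hpos _
  -- The tail mean is the optimal noise variance, and `betaHat` is its inverse.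
  obtain ⟨t, htdef⟩ : ∃ t, t = (∑ i ∈ Finset.univ.filter (fun i : Fin n => q ≤ i.val),
    eigAsc hG.isHermitian i) / (n - q) := ⟨_, rfl⟩
  have hlt : ∑ i ∈ Finset.univ.filter (fun i : Fin n => q ≤ i.val), eigAsc hG.isHermitian i =
      (n - q) * t := by rw [htdef, mul_div_cancel₀ _ hnq.ne']
  have ht : 0 < t := by
    rw [htdef]
    exact div_pos (Finset.sum_pos (fun i _ => hpos i) ⟨⟨q, hq⟩, by simp⟩) hnq
  have hb : betaHat q hG.isHermitian = t⁻¹ := by rw [htdef, inv_div, betaHat]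
  have hle : ∀ j : Fin q, t⁻¹ ≤ (minorEig hq hG.isHermitian j)⁻¹ := fun j => by
    refine inv_anti₀ (hl0 j) ?_
    rw [htdef, le_div_iff₀ hnq, mul_comm, ← card_filter_le_val hq.le, ← nsmul_eq_mul]
    refine Finset.card_nsmul_le_sum _ _ _ fun i hi => hl (Fin.le_def.2 ?_)
    exact j.isLt.le.trans (by simpa using hi)
  rw [hb]
  obtain ⟨f, hf⟩ := exists_colMatrix_mul_transpose_eq hG.posSemidef
    ((rank_le_width G).trans hnd) d.cast_nonneg
  have hmin := fun (X : Matrix (Fin n) (Fin q) ℝ) (b : ℝ) (hb : 0 < b) =>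
    optimalLoss_le_wishartLoss_minor hq hQ hl hl0 ht hlt X hb
  have hval : ∀ X, IsScaledMinor hq hG.isHermitian t⁻¹ X →
      wishartLoss G (X * Xᵀ + t⁻¹ • (1 : Matrix (Fin n) (Fin n) ℝ))⁻¹ = optimalLoss hq.le
        (eigAsc hG.isHermitian) t := fun X hX => by
    obtain ⟨U, hU, hXU⟩ := (isScaledMinor_iff hq hG.isHermitian hle X).1 hX
    -- Inverting the precision gives `U (Λ - t) Uᵀ + t I`, the same form of scale matrix as in the
    -- covariance model, so the same evaluation applies.
    rw [hXU, inv_low_rank_add_smul_one hU.1 (inv_ne_zero ht.ne')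
      (fun j => by rw [sub_add_cancel]; exact inv_ne_zero (hl0 j).ne')]
    simp only [sub_add_cancel, inv_inv]
    exact wishartLoss_eq_optimalLoss hq hQ.trace hl0 ht hlt hU
  obtain ⟨X₀, hX₀⟩ : ∃ X, IsScaledMinor hq hG.isHermitian t⁻¹ X := by
    obtain ⟨X, hX⟩ := exists_mul_transpose_eq (fun j => sub_nonneg.2 (hle j))
      (Q.submatrix id (Fin.castLE hq.le))
    exact ⟨X, (isScaledMinor_iff hq hG.isHermitian hle X).2 ⟨_, hQ.isEigenvectors hq.le, hX⟩⟩
  refine ⟨inv_pos.2 ht, hle, fun X b => ?_, fun X => ?_⟩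
  · refine (isMAP_wishart_iff (V := fun θ : Matrix (Fin n) (Fin q) ℝ × Set.Ioi (0 : ℝ) =>
      (θ.1 * θ.1ᵀ + (θ.2 : ℝ) • (1 : Matrix (Fin n) (Fin n) ℝ))⁻¹) hd
      (fun θ => (posDef_mul_transpose_add_smul_one θ.1 θ.2.2).inv) hf
      (X, b)).trans ?_
    refine forall_le_iff_of_forall_le
      (p := fun θ : Matrix (Fin n) (Fin q) ℝ × Set.Ioi (0 : ℝ) => (θ.2 : ℝ) = t⁻¹ ∧
        IsScaledMinor hq hG.isHermitian t⁻¹ θ.1)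
      (fun θ => (hmin θ.1 θ.2 θ.2.2).1) (fun θ => ⟨fun h => ?_, fun h => ?_⟩)
      ⟨(X₀, ⟨t⁻¹, inv_pos.2 ht⟩), rfl, hX₀⟩ (X, b)
    · have h1 := (hmin θ.1 θ.2 θ.2.2).2 h
      exact ⟨h1.1, (isScaledMinor_iff hq hG.isHermitian hle _).2 h1.2⟩
    · rw [h.1]; exact hval _ h.2
  · refine (isMAP_wishart_iff (V := fun X : Matrix (Fin n) (Fin q) ℝ =>
      (X * Xᵀ + t⁻¹ • (1 : Matrix (Fin n) (Fin n) ℝ))⁻¹) hd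
      (fun X => (posDef_mul_transpose_add_smul_one X (inv_pos.2 ht)).inv) hf X).trans ?_
    refine forall_le_iff_of_forall_le (fun X => (hmin X _ (inv_pos.2 ht)).1)
      (fun X => ⟨fun h => ?_, hval X⟩) ⟨X₀, hX₀⟩ X
    exact (isScaledMinor_iff hq hG.isHermitian hle _).2 ((hmin X _ (inv_pos.2 ht)).2 h).2

end Estimates

theorem theorem2 (n q d : ℕ) (hq : q < n) :
    (∀ (S : Matrix (Fin n) (Fin n) ℝ) (hS : S.PosSemidef), q < S.rank → S.rank ≤ d →
      0 < sigmaSqHat q hS.isHermitian ∧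
      (∀ j : Fin q, sigmaSqHat q hS.isHermitian ≤ majorEig hq hS.isHermitian j) ∧
      (∀ (X : Matrix (Fin n) (Fin q) ℝ) (s : Set.Ioi (0 : ℝ)),
        IsMAP (fun θ : Matrix (Fin n) (Fin q) ℝ × Set.Ioi (0 : ℝ) =>
            wishart (θ.1 * θ.1ᵀ + (θ.2 : ℝ) • (1 : Matrix (Fin n) (Fin n) ℝ)) d)
          (flatPrior (Matrix (Fin n) (Fin q) ℝ × Set.Ioi (0 : ℝ))) ((d : ℝ) • S) (X, s) ↔
        (s : ℝ) = sigmaSqHat q hS.isHermitian ∧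
          IsScaledMajor hq hS.isHermitian (sigmaSqHat q hS.isHermitian) X) ∧
      (∀ X : Matrix (Fin n) (Fin q) ℝ,
        IsMAP (fun X' : Matrix (Fin n) (Fin q) ℝ =>
            wishart (X' * X'ᵀ +
              sigmaSqHat q hS.isHermitian • (1 : Matrix (Fin n) (Fin n) ℝ)) d)
          (flatPrior (Matrix (Fin n) (Fin q) ℝ)) ((d : ℝ) • S) X ↔
        IsScaledMajor hq hS.isHermitian (sigmaSqHat q hS.isHermitian) X)) ∧
    (∀ (G : Matrix (Fin n) (Fin n) ℝ) (hG : G.PosDef), n ≤ d →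
      0 < betaHat q hG.isHermitian ∧
      (∀ j : Fin q, betaHat q hG.isHermitian ≤ (minorEig hq hG.isHermitian j)⁻¹) ∧
      (∀ (X : Matrix (Fin n) (Fin q) ℝ) (b : Set.Ioi (0 : ℝ)),
        IsMAP (fun θ : Matrix (Fin n) (Fin q) ℝ × Set.Ioi (0 : ℝ) =>
            wishart (θ.1 * θ.1ᵀ + (θ.2 : ℝ) • (1 : Matrix (Fin n) (Fin n) ℝ))⁻¹ d)
          (flatPrior (Matrix (Fin n) (Fin q) ℝ × Set.Ioi (0 : ℝ))) ((d : ℝ) • G) (X, b) ↔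
        (b : ℝ) = betaHat q hG.isHermitian ∧
          IsScaledMinor hq hG.isHermitian (betaHat q hG.isHermitian) X) ∧
      (∀ X : Matrix (Fin n) (Fin q) ℝ,
        IsMAP (fun X' : Matrix (Fin n) (Fin q) ℝ =>
            wishart (X' * X'ᵀ +
              betaHat q hG.isHermitian • (1 : Matrix (Fin n) (Fin n) ℝ))⁻¹ d)
          (flatPrior (Matrix (Fin n) (Fin q) ℝ)) ((d : ℝ) • G) X ↔
        IsScaledMinor hq hG.isHermitian (betaHat q hG.isHermitian) X)) :=
  ⟨fun _ hS hqr hrd => isMAP_iff_isScaledMajor hq hS hqr hrd,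
    fun _ hG hnd => isMAP_iff_isScaledMinor hq hG hnd⟩
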